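/- For $\rho>0$ let $\varphi(\rho)=\max\{1,-\log\rho\}$, and for $\alpha,\beta\in\mathbf{R}$ let $w(x)=|x|^{\alpha}\varphi(|x|)^{\beta}$, $x\in\mathbf{R}^n\setminus\{0\}$. A nonnegative locally integrable function $w$ on $\mathbf{R}^n$ is called a $1$-admissible weight if the measure $d\mu=w\,dx$ has the following two properties. (i) $\mu$ is doubling: there is $C>0$ such that $0<\mu(B(x,2r))\le C\mu(B(x,r))<\infty$ for all $x\in\mathbf{R}^n$ and $r>0$. (ii) $\mu$ supports a $1$-Poincaré inequality: there are $C>0$ and $\lambda\ge1$ such that for all balls $B=B(x,r)$, all integrable functions $f:\mathbf{R}^n\to[-\infty,\infty]$ and all upper gradients $g$ of $f$, $$\frac1{\mu(B)}\int_B|f-f_B|\,d\mu\le \frac{Cr}{\mu(\lambda B)}\int_{\lambda B}g\,d\mu,\qquad f_B=\frac1{\mu(B)}\int_B f\,d\mu,\quad \lambda B=B(x,\lambda r).$$ Here a Borel function $g:\mathbf{R}^n\to[0,\infty]$ is an upper gradient of $f$ if $|f(\gamma(0))-f(\gamma(l))|\le\int_\gamma g\,ds$ for every nonconstant compact rectifiable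 curve $\gamma:[0,l]\to\mathbf{R}^n$ parametrized by arc length, the left-hand side being $\infty$ if $f(\gamma(0))$ or $f(\gamma(l))$ is infinite. **Theorem.** If $n\ge2$, $\alpha>-n$ and $\beta\in\mathbf{R}$, then $w$ is a $1$-admissible weight on $\mathbf{R}^n$. This is false for $n=1$: if $\alpha>0$, or if $\alpha=0$ and $\beta<0$, then $w$ is locally integrable on $\mathbf{R}$ but it is not a $1$-admissible weight. -/

import Mathlib

open MeasureTheory Set Metric
open scoped ENNReal

/-- `g` is an upper gradient of the extended real-valued function `f`: `g` is a Borel function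
with values in `[0,∞]` and `|f(γ(0)) - f(γ(l))| ≤ ∫_γ g ds` for every nonconstant compact
rectifiable curve `γ : [0,l] → X`, parametrized by arc length (`HasUnitSpeedOn` says that the
length of `γ` restricted to `[s,t] ⊆ [0,l]` is `t - s`; in particular `γ` is continuous on
`[0,l]`). The left-hand side is `∞` as soon as one of the two values of `f` is infinite: this is
what the conventions `⊤ - ⊤ = ⊥ - ⊥ = ⊥` and `|⊥| = ∞` of `EReal` give. -/
def IsUpperGradient {X : Type*} [MetricSpace X] [MeasurableSpace X]
    (g : X → ℝ≥0∞) (f : X → EReal) : Prop :=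
  Measurable g ∧
    ∀ (l : ℝ) (γ : ℝ → X), 0 < l → HasUnitSpeedOn γ (Icc 0 l) →
      (f (γ 0) - f (γ l)).abs ≤ ∫⁻ t in Icc 0 l, g (γ t)

/-- The convention on infinite values in the definition of upper gradients. -/
theorem EReal_abs_sub_eq_top {a b : EReal} (h : a = ⊤ ∨ a = ⊥ ∨ b = ⊤ ∨ b = ⊥) :
    (a - b).abs = ⊤ := by
  induction a <;> induction b <;> simp_all

/-- Integrability of an extended real-valued function: it is finite almost everywhere and
its real-valued representative is measurable and has finite `L¹` norm. -/
def IsIntegrableEReal {X : Type*} [MeasurableSpace X] (f : X → EReal) (μ : Measure X) : Prop :=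
  (∀ᵐ x ∂μ, f x ≠ ⊤ ∧ f x ≠ ⊥) ∧ Integrable (fun x => (f x).toReal) μ

/-- The measure `μ` is doubling: `0 < μ(2B) ≤ C μ(B) < ∞` for all balls `B`. -/
def IsDoublingMeasure {X : Type*} [MetricSpace X] [MeasurableSpace X] (μ : Measure X) : Prop :=
  ∃ C : ℝ, 0 < C ∧ ∀ (x : X) (r : ℝ), 0 < r →
    0 < μ (ball x (2 * r)) ∧
    μ (ball x (2 * r)) ≤ ENNReal.ofReal C * μ (ball x r) ∧
    ENNReal.ofReal C * μ (ball x r) < ∞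

/-- The measure `μ` supports a `p`-Poincaré inequality: there are `C > 0` and `Λ ≥ 1` with
`⨍_B |f - f_B| dμ ≤ C r (⨍_{ΛB} g ^ p dμ)^{1/p}` for all balls `B = B(x,r)`, all integrable `f`
and all upper gradients `g` of `f`. -/
def SupportsPoincare {X : Type*} [MetricSpace X] [MeasurableSpace X]
    (p : ℝ) (μ : Measure X) : Prop :=
  ∃ C Λ : ℝ, 0 < C ∧ 1 ≤ Λ ∧
    ∀ (x : X) (r : ℝ), 0 < r →
      ∀ (f : X → EReal) (g : X → ℝ≥0∞), IsIntegrableEReal f μ → IsUpperGradient g f →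
        (⨍⁻ y in ball x r, (f y - ((⨍ z in ball x r, (f z).toReal ∂μ : ℝ) : EReal)).abs ∂μ) ≤
          ENNReal.ofReal (C * r) * (⨍⁻ y in ball x (Λ * r), g y ^ p ∂μ) ^ (1 / p)

/-- A weight on `ℝⁿ`: a nonnegative locally integrable function. -/
def IsWeight {n : ℕ} (w : EuclideanSpace ℝ (Fin n) → ℝ) : Prop :=
  (∀ x, 0 ≤ w x) ∧ LocallyIntegrable w volume

/-- The measure `dμ = w dx`. -/
noncomputable def weightMeasure {n : ℕ} (w : EuclideanSpace ℝ (Fin n) → ℝ) :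
    Measure (EuclideanSpace ℝ (Fin n)) :=
  volume.withDensity fun x => ENNReal.ofReal (w x)

/-- `w` is a `p`-admissible weight on `ℝⁿ`: it is a weight, and `dμ = w dx` is doubling and
supports a `p`-Poincaré inequality on `ℝⁿ`. -/
def IsAdmissibleWeight {n : ℕ} (p : ℝ) (w : EuclideanSpace ℝ (Fin n) → ℝ) : Prop :=
  IsWeight w ∧ IsDoublingMeasure (weightMeasure w) ∧ SupportsPoincare p (weightMeasure w)

/-- `φ(ρ) = max {1, -log ρ}` for `ρ > 0`. -/
noncomputable def logCutoff (ρ : ℝ) : ℝ := max 1 (-Real.log ρ)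

/-- The logarithmic power weight `|x|^α φ(|x|)^β` on `ℝⁿ`. (Its value at the single point
`x = 0`, a null set for `n ≥ 1`, is irrelevant.) -/
noncomputable def logPowerWeight (n : ℕ) (α β : ℝ) (x : EuclideanSpace ℝ (Fin n)) : ℝ :=
  ‖x‖ ^ α * logCutoff ‖x‖ ^ β

/-! The radial profile varies by a bounded factor over comparable radii
(`exists_logPowerProfile_le`), so on a ball `B(x,r)` with `2r ≤ |x|`, or on a shell of bounded ratio
about the origin, `μ` is Lebesgue measure times a constant, and the Lebesgue Poincaré inequality
transfers. A ball with `|x| < 2r` is enlarged to `B(0,R)`, `R = 3r`, and treated in two steps.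

On the shell `R ≤ |y| < 2R` the Lebesgue inequality is proved by joining two points through
intermediate points whose directions make an angle of at most 120° with each of them; the segments
used then avoid `B(0,R/2)`. Two given points have many common intermediate points because for `n ≥
2` some unit vector has nonnegative inner product with both
(`exists_lintegral_originShell_abs_sub_const_le`).

From `B(0,R)` one moves out to the shell along rays: `|F(x) - c|` is bounded by an average of
`|F(sx) - c|` over those `s` with `sx` in the shell, plus the integral of `g` along the ray. Both
terms have the form `∫₁^∞ H(sx) ds/s`, an operator bounded on `L¹(μ)` exactly because the dilation
costs `s^(-n) w(y/s) ≲ s^(-(n+α)/2) w(y)` and `α > -n` (`exists_lintegral_radial_le`). With `F`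
constant the same estimate bounds `μ(B(0,R))` by the measure of the shell, which gives local
integrability and doubling, also for `n = 1`.

On the line the shell is disconnected and the argument breaks down. If `w(x) → 0` as `x → 0`, a ramp
from 0 to 1 on `[0,ε]` has gradient `1/ε` there and energy of the order of the supremum of `w` on
`(0,ε]`, which tends to 0, while its oscillation on `B(0,1)` stays bounded below. -/

/-! ### Growth of the radial profile -/

theorem one_le_logCutoff (ρ : ℝ) : 1 ≤ logCutoff ρ := le_max_left _ _

theorem logCutoff_pos (ρ : ℝ) : 0 < logCutoff ρ := zero_lt_one.trans_le (one_le_logCutoff ρ)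

theorem logCutoff_le_of_le {ρ σ : ℝ} (hρ : 0 < ρ) (h : ρ ≤ σ) : logCutoff σ ≤ logCutoff ρ :=
  max_le_max le_rfl (neg_le_neg (Real.log_le_log hρ h))

/-- Since `-log ρ ≤ log K - log σ` and the cutoff is at least 1, the additive loss `log K` can be
written as a factor. -/
theorem logCutoff_le_mul {ρ σ K : ℝ} (hρ : 0 < ρ) (hσ : 0 < σ) (hK : 1 ≤ K) (h : σ ≤ K * ρ) :
    logCutoff ρ ≤ (1 + Real.log K) * logCutoff σ := by
  have hlK : 0 ≤ Real.log K := Real.log_nonneg hK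
  have h1 := one_le_logCutoff σ
  refine max_le (by nlinarith) ?_
  have h2 : Real.log σ ≤ Real.log K + Real.log ρ := by
    rw [← Real.log_mul (by positivity) hρ.ne']
    exact Real.log_le_log hσ h
  have h3 : -Real.log σ ≤ logCutoff σ := le_max_right _ _
  nlinarith

/-- The radial profile of the weight `logPowerWeight`. -/
noncomputable def logPowerProfile (α β ρ : ℝ) : ℝ := ρ ^ α * logCutoff ρ ^ β

theorem logPowerProfile_pos (α β : ℝ) {ρ : ℝ} (hρ : 0 < ρ) : 0 < logPowerProfile α β ρ :=
  mul_pos (Real.rpow_pos_of_pos hρ _) (Real.rpow_pos_of_pos (logCutoff_pos _) _)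

theorem rpow_le_rpow_abs {x K : ℝ} (a : ℝ) (hx : 0 < x) (h1 : x ≤ K) (h2 : 1 ≤ K * x) :
    x ^ a ≤ K ^ |a| := by
  have hK : 0 < K := hx.trans_le h1
  rcases le_total 0 a with ha | ha
  · rw [abs_of_nonneg ha]; exact Real.rpow_le_rpow hx.le h1 ha
  · rw [abs_of_nonpos ha, ← inv_inv x, Real.inv_rpow (by positivity), ← Real.rpow_neg (by positivity)]
    refine Real.rpow_le_rpow (by positivity) ?_ (by linarith)
    rwa [inv_le_iff_one_le_mul₀ hx]

theorem exists_logPowerProfile_le (α β : ℝ) {K : ℝ} (hK : 1 ≤ K) :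
    ∃ C : ℝ, 0 < C ∧ ∀ ρ σ : ℝ, 0 < ρ → 0 < σ → ρ ≤ K * σ → σ ≤ K * ρ →
      logPowerProfile α β ρ ≤ C * logPowerProfile α β σ := by
  have hlK : 0 ≤ Real.log K := Real.log_nonneg hK
  refine ⟨K ^ |α| * (1 + Real.log K) ^ |β|, by positivity, fun ρ σ hρ hσ h1 h2 => ?_⟩
  have e1 : ρ ^ α ≤ K ^ |α| * σ ^ α := by
    rw [← div_le_iff₀ (by positivity), ← Real.div_rpow hρ.le hσ.le]
    refine rpow_le_rpow_abs α (by positivity) ((div_le_iff₀ hσ).2 h1) ?_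
    rw [← mul_div_assoc, le_div_iff₀ hσ]; linarith
  have p1 := logCutoff_pos ρ
  have p2 := logCutoff_pos σ
  have e2 : logCutoff ρ ^ β ≤ (1 + Real.log K) ^ |β| * logCutoff σ ^ β := by
    rw [← div_le_iff₀ (by positivity), ← Real.div_rpow p1.le p2.le]
    refine rpow_le_rpow_abs β (by positivity) ((div_le_iff₀ p2).2 (logCutoff_le_mul hρ hσ hK h2)) ?_
    rw [← mul_div_assoc, le_div_iff₀ p2, one_mul]; exact logCutoff_le_mul hσ hρ hK h1
  calc ρ ^ α * logCutoff ρ ^ β ≤ (K ^ |α| * σ ^ α) * ((1 + Real.log K) ^ |β| * logCutoff σ ^ β) := by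
        gcongr
    _ = _ := by unfold logPowerProfile; ring

/-- Shrinking the radius by `s` multiplies the cutoff by at most `1 + log s`, and any power of that
is absorbed by `s ^ ε`. For `β ≤ 0` the logarithmic factor can only decrease. -/
theorem exists_logPowerProfile_div_le (α β : ℝ) {ε : ℝ} (hε : 0 < ε) :
    ∃ C : ℝ, 0 < C ∧ ∀ ρ s : ℝ, 0 < ρ → 1 ≤ s →
      logPowerProfile α β (ρ / s) ≤ C * s ^ (-α + ε) * logPowerProfile α β ρ := by
  have key : ∃ C : ℝ, 0 < C ∧ ∀ ρ s : ℝ, 0 < ρ → 1 ≤ s →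
      logCutoff (ρ / s) ^ β ≤ C * s ^ ε * logCutoff ρ ^ β := by
    rcases le_or_gt β 0 with hβ | hβ
    · refine ⟨1, one_pos, fun ρ s hρ hs => ?_⟩
      have h1 : logCutoff (ρ / s) ^ β ≤ logCutoff ρ ^ β :=
        Real.rpow_le_rpow_of_nonpos (logCutoff_pos _)
          (logCutoff_le_of_le (by positivity) (div_le_self hρ.le hs)) hβ
      have h2 : 1 ≤ s ^ ε := Real.one_le_rpow hs hε.le
      have h3 : 0 < logCutoff ρ ^ β := Real.rpow_pos_of_pos (logCutoff_pos _) _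
      nlinarith
    · refine ⟨(1 + β / ε) ^ β, by positivity, fun ρ s hρ hs => ?_⟩
      have hs0 : 0 < s := by linarith
      have h1 : logCutoff (ρ / s) ≤ (1 + Real.log s) * logCutoff ρ :=
        logCutoff_le_mul (by positivity) hρ hs (by rw [mul_div_cancel₀ _ hs0.ne'])
      have h2 : 1 + Real.log s ≤ (1 + β / ε) * s ^ (ε / β) := by
        have := Real.log_le_rpow_div hs0.le (div_pos hε hβ)
        have h3 : 1 ≤ s ^ (ε / β) := Real.one_le_rpow hs (by positivity)
        -- The exponent `ε / β` is chosen so that the `β`-th power below returns `s ^ ε`.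
        rw [div_div_eq_mul_div, mul_div_assoc] at this
        nlinarith
      have p := logCutoff_pos ρ
      calc logCutoff (ρ / s) ^ β ≤ ((1 + β / ε) * s ^ (ε / β) * logCutoff ρ) ^ β := by
            refine Real.rpow_le_rpow (logCutoff_pos _).le (h1.trans ?_) hβ.le
            gcongr
        _ = _ := by
            rw [Real.mul_rpow (by positivity) p.le, Real.mul_rpow (by positivity) (by positivity),
              ← Real.rpow_mul hs0.le, div_mul_cancel₀ _ hβ.ne']
  obtain ⟨C, hC, h⟩ := key
  refine ⟨C, hC, fun ρ s hρ hs => ?_⟩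
  have hs0 : 0 < s := by linarith
  have := h ρ s hρ hs
  unfold logPowerProfile
  rw [Real.div_rpow hρ.le hs0.le, Real.rpow_add hs0, Real.rpow_neg hs0.le, div_eq_mul_inv]
  calc ρ ^ α * (s ^ α)⁻¹ * logCutoff (ρ / s) ^ β
      ≤ ρ ^ α * (s ^ α)⁻¹ * (C * s ^ ε * logCutoff ρ ^ β) := by gcongr
    _ = _ := by ring

/-! ### Segments as unit-speed curves, and affine changes of variables -/

theorem hasUnitSpeedOn_of_edist_eq {X : Type*} [PseudoEMetricSpace X] {γ : ℝ → X} (s : Set ℝ)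
    (h : ∀ a b, edist (γ a) (γ b) = edist a b) : HasUnitSpeedOn γ s := by
  have h1 : ∀ t : Set ℝ, eVariationOn γ t = eVariationOn (id : ℝ → ℝ) t := by
    intro t
    simp only [eVariationOn, h, id]
  rw [HasUnitSpeedOn, hasConstantSpeedOnWith_iff_ordered]
  intro x hx y hy hxy
  rw [h1, monotone_id.monotoneOn _ |>.eVariationOn_eq hx hy]
  simp

theorem lintegral_comp_smul_eq {E : Type*} [NormedAddCommGroup E] [NormedSpace ℝ E]
    [MeasurableSpace E] [BorelSpace E] [FiniteDimensional ℝ E] (μ : Measure E) [μ.IsAddHaarMeasure]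
    (h : E → ℝ≥0∞) {s : ℝ} (hs : 0 < s) :
    ∫⁻ x, h (s • x) ∂μ = ENNReal.ofReal ((s ^ Module.finrank ℝ E)⁻¹) * ∫⁻ x, h x ∂μ := by
  have h1 := Measure.map_addHaar_smul μ hs.ne'
  rw [abs_of_pos (by positivity)] at h1
  rw [← smul_eq_mul, ← lintegral_smul_measure, ← h1]
  exact ((Homeomorph.smulOfNeZero s hs.ne').toMeasurableEquiv.measurableEmbedding.lintegral_map
    h).symm

theorem lintegral_comp_add_smul_eq {E : Type*} [NormedAddCommGroup E] [NormedSpace ℝ E]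
    [MeasurableSpace E] [BorelSpace E] [FiniteDimensional ℝ E] (μ : Measure E) [μ.IsAddHaarMeasure]
    (h : E → ℝ≥0∞) (a : E) {s : ℝ} (hs : 0 < s) :
    ∫⁻ x, h (a + s • x) ∂μ = ENNReal.ofReal ((s ^ Module.finrank ℝ E)⁻¹) * ∫⁻ x, h x ∂μ := by
  rw [lintegral_comp_smul_eq μ (fun x => h (a + x)) hs, lintegral_add_left_eq_self h a]

theorem setLIntegral_Icc_comp_affine (h : ℝ → ℝ≥0∞) (a : ℝ) {b c : ℝ} (hb : 0 < b) :
    ENNReal.ofReal b * ∫⁻ t in Icc 0 c, h (a + b * t) = ∫⁻ τ in Icc a (a + b * c), h τ := by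
  rw [← lintegral_indicator measurableSet_Icc, ← lintegral_indicator measurableSet_Icc]
  have h1 := lintegral_comp_add_smul_eq volume ((Icc a (a + b * c)).indicator h) a hb
  simp only [smul_eq_mul, Module.finrank_self, pow_one] at h1
  have h2 : ∀ t, (Icc 0 c).indicator (fun t => h (a + b * t)) t =
      (Icc a (a + b * c)).indicator h (a + b * t) := by
    intro t
    by_cases ht : t ∈ Icc 0 c
    · rw [indicator_of_mem ht, indicator_of_mem]
      exact ⟨by nlinarith [ht.1], by nlinarith [ht.2]⟩
    · rw [indicator_of_notMem ht, indicator_of_notMem]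
      refine fun h' => ht ⟨?_, ?_⟩
      · by_contra! h3; nlinarith [h'.1]
      · by_contra! h3; nlinarith [h'.2]
  simp_rw [h2, h1]
  rw [← mul_assoc, ← ENNReal.ofReal_mul hb.le, mul_inv_cancel₀ hb.ne', ENNReal.ofReal_one, one_mul]

/-- The only curves needed for the positive result are segments: the unit-speed parametrization is
tested and then rescaled to `[0,1]`. -/
theorem IsUpperGradient.abs_sub_le_segment {E : Type*} [NormedAddCommGroup E] [NormedSpace ℝ E]
    [MeasurableSpace E] {g : E → ℝ≥0∞} {f : E → EReal} (hg : IsUpperGradient g f) (x : E) {y : E}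
    (hy : y ≠ x) :
    (f x - f y).abs ≤ ENNReal.ofReal ‖y - x‖ * ∫⁻ t in Icc (0 : ℝ) 1, g (x + t • (y - x)) := by
  have hl : 0 < ‖y - x‖ := norm_pos_iff.2 (sub_ne_zero.2 hy)
  set l := ‖y - x‖ with hl'
  have hu : ‖l⁻¹ • (y - x)‖ = 1 := by
    rw [norm_smul, ← hl', Real.norm_of_nonneg (by positivity), inv_mul_cancel₀ hl.ne']
  have h1 := hg.2 l (fun t => x + t • l⁻¹ • (y - x)) hl
    (hasUnitSpeedOn_of_edist_eq _ fun a b => by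
      rw [edist_add_left, edist_dist, edist_dist, dist_eq_norm, ← sub_smul, norm_smul, hu, mul_one,
        Real.dist_eq, Real.norm_eq_abs])
  have h2 := setLIntegral_Icc_comp_affine (fun t => g (x + t • l⁻¹ • (y - x))) 0 (c := 1) hl
  simp only [zero_add, mul_one] at h2
  rw [← h2] at h1
  simp only [zero_smul, add_zero] at h1
  simp only [smul_smul, mul_inv_cancel₀ hl.ne', one_smul,
    add_sub_cancel] at h1
  convert h1 using 6 with t
  rw [mul_right_comm, mul_inv_cancel₀ hl.ne', one_mul]

/-! ### The weighted measure under dilations and on annuli -/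

theorem measurable_logPowerWeight (n : ℕ) (α β : ℝ) : Measurable (logPowerWeight n α β) := by
  unfold logPowerWeight logCutoff
  fun_prop

theorem logPowerWeight_nonneg (n : ℕ) (α β : ℝ) (x : EuclideanSpace ℝ (Fin n)) :
    0 ≤ logPowerWeight n α β x :=
  mul_nonneg (Real.rpow_nonneg (norm_nonneg _) _) (Real.rpow_nonneg (logCutoff_pos _).le _)

theorem lintegral_weightMeasure {n : ℕ} {w : EuclideanSpace ℝ (Fin n) → ℝ} (hw : Measurable w)
    {h : EuclideanSpace ℝ (Fin n) → ℝ≥0∞} (hh : Measurable h) :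
    ∫⁻ x, h x ∂weightMeasure w = ∫⁻ x, ENNReal.ofReal (w x) * h x :=
  lintegral_withDensity_eq_lintegral_mul _ hw.ennreal_ofReal hh

theorem setLIntegral_weightMeasure {n : ℕ} {w : EuclideanSpace ℝ (Fin n) → ℝ} (hw : Measurable w)
    {h : EuclideanSpace ℝ (Fin n) → ℝ≥0∞} (hh : Measurable h)
    {A : Set (EuclideanSpace ℝ (Fin n))} (hA : MeasurableSet A) :
    ∫⁻ x in A, h x ∂weightMeasure w = ∫⁻ x in A, ENNReal.ofReal (w x) * h x :=
  setLIntegral_withDensity_eq_setLIntegral_mul _ hw.ennreal_ofReal hh hA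

/-- Averaging over dilations `x ↦ s • x`, `s > 1`, is bounded on `L¹` of the weighted measure. -/
theorem exists_lintegral_radial_le {n : ℕ} (hn : 0 < n) {α : ℝ} (β : ℝ) (hα : -(n : ℝ) < α) :
    ∃ C : ℝ≥0∞, C ≠ ∞ ∧ ∀ H : EuclideanSpace ℝ (Fin n) → ℝ≥0∞, Measurable H →
      ∫⁻ x, ∫⁻ s in Ioi (1 : ℝ), ENNReal.ofReal s⁻¹ * H (s • x)
          ∂(volume : Measure ℝ) ∂weightMeasure (logPowerWeight n α β) ≤
        C * ∫⁻ x, H x ∂weightMeasure (logPowerWeight n α β) := by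
  have : Nonempty (Fin n) := ⟨⟨0, hn⟩⟩
  -- With this `ε` the factors `s⁻¹`, `s ^ (-n)` (Jacobian) and `s ^ (-α + ε)` (weight) multiply to
  -- `s ^ (-1 - (n + α) / 2)`, integrable at infinity because `α > -n`.
  obtain ⟨C, hC, hle⟩ := exists_logPowerProfile_div_le α β (ε := (n + α) / 2) (by linarith)
  have hint : IntegrableOn (fun s : ℝ => s ^ (-1 - (n + α) / 2)) (Ioi 1) :=
    (integrableOn_Ioi_rpow_iff one_pos).2 (by linarith)
  refine ⟨ENNReal.ofReal C * ∫⁻ s in Ioi (1 : ℝ), ENNReal.ofReal (s ^ (-1 - (n + α) / 2)),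
    ENNReal.mul_ne_top ENNReal.ofReal_ne_top ?_, fun H hH => ?_⟩
  · rw [← ofReal_integral_eq_lintegral_ofReal hint]
    · exact ENNReal.ofReal_ne_top
    · filter_upwards [ae_restrict_mem measurableSet_Ioi] with s hs
      exact Real.rpow_nonneg (zero_le_one.trans (le_of_lt hs)) _
  have hw := measurable_logPowerWeight n α β
  have : SFinite (weightMeasure (logPowerWeight n α β)) := by unfold weightMeasure; infer_instance
  rw [lintegral_lintegral_swap, mul_right_comm, ← lintegral_const_mul _ (by fun_prop)]
  swap
  · refine Measurable.aemeasurable ?_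
    fun_prop
  refine setLIntegral_mono' measurableSet_Ioi fun s hs => ?_
  have hs1 : (1 : ℝ) < s := hs
  have hs0 : 0 < s := by linarith
  rw [lintegral_const_mul _ (by fun_prop), lintegral_weightMeasure hw (by fun_prop)]
  have h1 : ∫⁻ x, ENNReal.ofReal (logPowerWeight n α β x) * H (s • x) =
      ENNReal.ofReal ((s ^ n)⁻¹) *
        ∫⁻ y, ENNReal.ofReal (logPowerWeight n α β (s⁻¹ • y)) * H y := by
    have := lintegral_comp_smul_eq volume
      (fun y => ENNReal.ofReal (logPowerWeight n α β (s⁻¹ • y)) * H y) hs0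
    simpa [smul_smul, inv_mul_cancel₀ hs0.ne'] using this
  have h2 : ∫⁻ y, ENNReal.ofReal (logPowerWeight n α β (s⁻¹ • y)) * H y ≤
      ENNReal.ofReal (C * s ^ (-α + (n + α) / 2)) *
        ∫⁻ y, ENNReal.ofReal (logPowerWeight n α β y) * H y := by
    rw [← lintegral_const_mul _ (by fun_prop)]
    refine lintegral_mono_ae ?_
    filter_upwards [compl_mem_ae_iff.2 (measure_singleton (0 : EuclideanSpace ℝ (Fin n)))] with y hy
    have hy' : 0 < ‖y‖ := norm_pos_iff.2 hy
    rw [← mul_assoc, ← ENNReal.ofReal_mul (by positivity)]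
    gcongr
    have := hle ‖y‖ s hy' hs1.le
    unfold logPowerWeight
    rw [norm_smul, norm_inv, Real.norm_of_nonneg hs0.le, inv_mul_eq_div]
    exact this
  rw [h1]
  calc ENNReal.ofReal s⁻¹ * (ENNReal.ofReal ((s ^ n)⁻¹) *
        ∫⁻ y, ENNReal.ofReal (logPowerWeight n α β (s⁻¹ • y)) * H y)
      ≤ ENNReal.ofReal s⁻¹ * (ENNReal.ofReal ((s ^ n)⁻¹) *
        (ENNReal.ofReal (C * s ^ (-α + (n + α) / 2)) *
        ∫⁻ y, ENNReal.ofReal (logPowerWeight n α β y) * H y)) := by gcongr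
    _ = ENNReal.ofReal (s⁻¹ * (s ^ n)⁻¹ * (C * s ^ (-α + (n + α) / 2))) *
        ∫⁻ y, ENNReal.ofReal (logPowerWeight n α β y) * H y := by
        rw [ENNReal.ofReal_mul (p := s⁻¹ * (s ^ n)⁻¹) (by positivity),
          ENNReal.ofReal_mul (p := s⁻¹) (by positivity)]
        simp only [mul_assoc]
    _ = ENNReal.ofReal C * (∫⁻ y, ENNReal.ofReal (logPowerWeight n α β y) * H y) *
        ENNReal.ofReal (s ^ (-1 - (n + α) / 2)) := by
        have : s⁻¹ * (s ^ n)⁻¹ * (C * s ^ (-α + (n + α) / 2)) = C * s ^ (-1 - (n + α) / 2) := by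
          rw [← Real.rpow_natCast, ← Real.rpow_neg_one, ← Real.rpow_neg hs0.le, mul_left_comm,
            ← Real.rpow_add hs0, ← Real.rpow_add hs0]
          congr 2; ring
        rw [this, ENNReal.ofReal_mul hC.le]; ring
    _ = _ := by rw [lintegral_weightMeasure hw hH]

theorem exists_setLIntegral_weightMeasure_comparable (n : ℕ) (α β : ℝ) {K : ℝ} (hK : 1 ≤ K) :
    ∃ C : ℝ, 0 < C ∧ ∀ (ρ : ℝ) (A : Set (EuclideanSpace ℝ (Fin n))), 0 < ρ → MeasurableSet A →
      (∀ y ∈ A, ρ ≤ K * ‖y‖ ∧ ‖y‖ ≤ K * ρ) →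
      ∀ h : EuclideanSpace ℝ (Fin n) → ℝ≥0∞, Measurable h →
        (∫⁻ y in A, h y ∂weightMeasure (logPowerWeight n α β) ≤
          ENNReal.ofReal C * ENNReal.ofReal (logPowerProfile α β ρ) * ∫⁻ y in A, h y) ∧
        (ENNReal.ofReal (logPowerProfile α β ρ) * ∫⁻ y in A, h y ≤
          ENNReal.ofReal C * ∫⁻ y in A, h y ∂weightMeasure (logPowerWeight n α β)) := by
  obtain ⟨C, hC, hle⟩ := exists_logPowerProfile_le α β hK
  refine ⟨C, hC, fun ρ A hρ hA hy h hh => ?_⟩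
  have hpos : ∀ y ∈ A, 0 < ‖y‖ := fun y h' => by
    by_contra! h0
    have := (hy y h').1
    nlinarith
  have hw := measurable_logPowerWeight n α β
  rw [setLIntegral_weightMeasure hw hh hA, ← lintegral_const_mul _ hh, ← lintegral_const_mul _ hh,
    ← lintegral_const_mul _ (by fun_prop)]
  constructor
  · refine setLIntegral_mono' hA fun y hyA => ?_
    rw [← ENNReal.ofReal_mul hC.le]
    gcongr
    exact hle _ _ (hpos y hyA) hρ (hy y hyA).2 (hy y hyA).1
  · refine setLIntegral_mono' hA fun y hyA => ?_
    rw [← mul_assoc, ← ENNReal.ofReal_mul hC.le]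
    gcongr
    exact hle _ _ hρ (hpos y hyA) (hy y hyA).1 (hy y hyA).2

/-! ### Lebesgue Poincaré inequalities from segments -/

section Segments

variable {E : Type*} [NormedAddCommGroup E] [NormedSpace ℝ E] [MeasurableSpace E] [BorelSpace E]
  [FiniteDimensional ℝ E] (μ : Measure E) [μ.IsAddHaarMeasure]

theorem lintegral_comp_add_smul_le {h : E → ℝ≥0∞} (a : E) {s : ℝ} (hs : 1 / 2 ≤ s) :
    ∫⁻ x, h (a + s • x) ∂μ ≤ 2 ^ Module.finrank ℝ E * ∫⁻ x, h x ∂μ := by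
  have hs0 : 0 < s := by linarith
  rw [lintegral_comp_add_smul_eq μ h a hs0]
  gcongr
  rw [← inv_pow, ENNReal.ofReal_pow (by positivity)]
  gcongr
  rw [show (2 : ℝ≥0∞) = ENNReal.ofReal 2 by simp]
  gcongr
  rw [inv_le_comm₀ hs0 two_pos]
  linarith

/-- The point of the segment is `(1 - t) z + t v`. One of the two coefficients is at least 1/2;
integrating first in the corresponding variable costs a Jacobian of at most `2 ^ dim`. -/
theorem lintegral_lintegral_segment_le {h : E → ℝ≥0∞} (hh : Measurable h) (A : Set E) (t : ℝ) :
    ∫⁻ z in A, ∫⁻ v in A, h (z + t • (v - z)) ∂μ ∂μ ≤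
      2 ^ Module.finrank ℝ E * μ A * ∫⁻ x, h x ∂μ := by
  have key : ∀ s : ℝ, 1 / 2 ≤ s → ∫⁻ z in A, ∫⁻ v in A, h ((1 - s) • z + s • v) ∂μ ∂μ ≤
      2 ^ Module.finrank ℝ E * μ A * ∫⁻ x, h x ∂μ := by
    intro s hs
    calc ∫⁻ z in A, ∫⁻ v in A, h ((1 - s) • z + s • v) ∂μ ∂μ
        ≤ ∫⁻ z in A, 2 ^ Module.finrank ℝ E * ∫⁻ x, h x ∂μ ∂μ :=
          lintegral_mono fun z => (setLIntegral_le_lintegral _ _).trans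
            (lintegral_comp_add_smul_le μ ((1 - s) • z) hs)
      _ = _ := by rw [setLIntegral_const]; ring
  have hform : ∀ z v : E, z + t • (v - z) = (1 - t) • z + t • v := fun z v => by
    rw [smul_sub, sub_smul, one_smul]; abel
  simp_rw [hform]
  rcases le_total (1 / 2) t with h1 | h1
  · exact key t h1
  · rw [lintegral_lintegral_swap (by fun_prop)]
    have := key (1 - t) (by linarith)
    simpa [add_comm] using this

variable {F : E → ℝ} {g : E → ℝ≥0∞} {N : Set E}

theorem lintegral_lintegral_abs_sub_le (hg : Measurable g) (hN : μ N = 0)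
    (hseg : ∀ x ∉ N, ∀ y ∉ N, ENNReal.ofReal |F x - F y| ≤
      ENNReal.ofReal ‖y - x‖ * ∫⁻ t in Icc (0 : ℝ) 1, g (x + t • (y - x)))
    {A D : Set E} {P : E → E → Prop} {d : ℝ} (hA : MeasurableSet A) (hD : MeasurableSet D)
    (hd : ∀ z ∈ A, ∀ v ∈ A, ‖v - z‖ ≤ d)
    (hP : ∀ z ∈ A, ∀ v ∈ A, P z v → ∀ t ∈ Icc (0 : ℝ) 1, z + t • (v - z) ∈ D) :
    ∫⁻ z in A, ∫⁻ v in A, {v | P z v}.indicator (fun v => ENNReal.ofReal |F z - F v|) v ∂μ ∂μ ≤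
      ENNReal.ofReal d * (2 ^ Module.finrank ℝ E * μ A * ∫⁻ x in D, g x ∂μ) := by
  have hk : Measurable (D.indicator g) := hg.indicator hD
  have hN' : ∀ᵐ z ∂μ.restrict A, z ∈ A ∧ z ∉ N := by
    filter_upwards [ae_restrict_mem hA, ae_restrict_of_ae (compl_mem_ae_iff.2 hN)] with z h1 h2
    exact ⟨h1, h2⟩
  calc _ ≤ ∫⁻ z in A, ∫⁻ v in A, ENNReal.ofReal d *
        (∫⁻ t in Icc (0 : ℝ) 1, D.indicator g (z + t • (v - z))) ∂μ ∂μ := by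
        refine lintegral_mono_ae ?_
        filter_upwards [hN'] with z hz
        refine lintegral_mono_ae ?_
        filter_upwards [hN'] with v hv
        by_cases hzv : P z v
        · rw [indicator_of_mem (show v ∈ {v | P z v} from hzv)]
          refine (hseg z hz.2 v hv.2).trans ?_
          gcongr ENNReal.ofReal ?_ * ?_
          · exact hd z hz.1 v hv.1
          · refine setLIntegral_mono' measurableSet_Icc fun t ht => ?_
            rw [indicator_of_mem (hP z hz.1 v hv.1 hzv t ht)]
        · rw [indicator_of_notMem (show v ∉ {v | P z v} from hzv)]
          exact zero_le
    _ = ENNReal.ofReal d * ∫⁻ t in Icc (0 : ℝ) 1, ∫⁻ z in A, ∫⁻ v in A,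
          D.indicator g (z + t • (v - z)) ∂μ ∂μ := by
        have h1 : ∀ z, ∫⁻ v in A, ENNReal.ofReal d *
            (∫⁻ t in Icc (0 : ℝ) 1, D.indicator g (z + t • (v - z))) ∂μ =
            ENNReal.ofReal d * ∫⁻ t in Icc (0 : ℝ) 1, ∫⁻ v in A,
              D.indicator g (z + t • (v - z)) ∂μ := by
          intro z
          rw [lintegral_const_mul' _ _ ENNReal.ofReal_ne_top, lintegral_lintegral_swap]
          exact (hk.comp (by fun_prop)).aemeasurable
        simp_rw [h1]
        rw [lintegral_const_mul' _ _ ENNReal.ofReal_ne_top, lintegral_lintegral_swap]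
        refine Measurable.aemeasurable ?_
        refine Measurable.lintegral_prod_right' (f := fun p : (E × ℝ) × E =>
          D.indicator g (p.1.1 + p.1.2 • (p.2 - p.1.1))) (hk.comp (by fun_prop))
    _ ≤ ENNReal.ofReal d * ∫⁻ t in Icc (0 : ℝ) 1,
          (2 ^ Module.finrank ℝ E * μ A * ∫⁻ x, D.indicator g x ∂μ) := by
        gcongr ENNReal.ofReal d * ?_
        exact setLIntegral_mono' measurableSet_Icc fun t _ =>
          lintegral_lintegral_segment_le μ hk A t
    _ = _ := by
        rw [setLIntegral_const, lintegral_indicator hD]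
        simp

/-- A Poincaré inequality on a set in which any two points have many common neighbours for a
relation whose pairs are joined by segments inside `D`. -/
theorem exists_lintegral_abs_sub_const_le (hF : Measurable F) (hg : Measurable g) (hN : μ N = 0)
    (hseg : ∀ x ∉ N, ∀ y ∉ N, ENNReal.ofReal |F x - F y| ≤
      ENNReal.ofReal ‖y - x‖ * ∫⁻ t in Icc (0 : ℝ) 1, g (x + t • (y - x)))
    {A D : Set E} {P : E → E → Prop} {d : ℝ} (hA : MeasurableSet A) (hD : MeasurableSet D)
    (hA0 : μ A ≠ 0) (hAtop : μ A ≠ ∞)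
    (hd : ∀ z ∈ A, ∀ v ∈ A, ‖v - z‖ ≤ d)
    (hPm : MeasurableSet {p : E × E | P p.1 p.2})
    (hP : ∀ z ∈ A, ∀ v ∈ A, P z v → ∀ t ∈ Icc (0 : ℝ) 1, z + t • (v - z) ∈ D)
    {m : ℝ≥0∞} (hm : ∀ z ∈ A, ∀ z' ∈ A, m ≤ μ {v ∈ A | P z v ∧ P z' v}) :
    ∃ c : ℝ, m * ∫⁻ z in A, ENNReal.ofReal |F z - c| ∂μ ≤
      2 * (ENNReal.ofReal d * (2 ^ Module.finrank ℝ E * μ A * ∫⁻ x in D, g x ∂μ)) := by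
  have hle := lintegral_lintegral_abs_sub_le μ hg hN hseg hA hD hd hP
  set J : E → ℝ≥0∞ := fun z =>
    ∫⁻ v in A, {v | P z v}.indicator (fun v => ENNReal.ofReal |F z - F v|) v ∂μ with hJ
  have hprod : Measurable fun p : E × E =>
      {p : E × E | P p.1 p.2}.indicator (fun p => ENNReal.ofReal |F p.1 - F p.2|) p :=
    Measurable.indicator (by fun_prop) hPm
  have hJm : Measurable J := hprod.lintegral_prod_right'
  -- The constant will be `F z'`, at a point where `J` does not exceed its average. Going from `z`
  -- to `z'` through a common neighbour `v` and integrating over `v` gives `m |F z - F z'| ≤ J z + J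
  -- z'`.
  obtain ⟨z', hz', hJz'⟩ := exists_le_setLAverage hA0 hAtop hJm.aemeasurable
  have hJz'' : μ A * J z' ≤ ∫⁻ z in A, J z ∂μ := by
    rw [setLAverage_eq, ENNReal.le_div_iff_mul_le (Or.inl hA0) (Or.inl hAtop)] at hJz'
    rwa [mul_comm]
  have hPz : ∀ z, MeasurableSet {v | P z v} := fun z =>
    hPm.preimage (measurable_const.prodMk measurable_id)
  have hpt : ∀ z ∈ A, m * ENNReal.ofReal |F z - F z'| ≤ J z + J z' := by
    intro z hz
    have hB : MeasurableSet {v ∈ A | P z v ∧ P z' v} := hA.inter ((hPz z).inter (hPz z'))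
    calc m * ENNReal.ofReal |F z - F z'|
        ≤ ∫⁻ v in {v ∈ A | P z v ∧ P z' v}, ENNReal.ofReal |F z - F z'| ∂μ := by
          rw [setLIntegral_const, mul_comm]; gcongr; exact hm z hz z' hz'
      _ ≤ ∫⁻ v in {v ∈ A | P z v ∧ P z' v},
            ({v | P z v}.indicator (fun v => ENNReal.ofReal |F z - F v|) v +
            {v | P z' v}.indicator (fun v => ENNReal.ofReal |F z' - F v|) v) ∂μ := by
          refine setLIntegral_mono' hB fun v hv => ?_
          rw [indicator_of_mem (show v ∈ {v | P z v} from hv.2.1),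
            indicator_of_mem (show v ∈ {v | P z' v} from hv.2.2),
            ← ENNReal.ofReal_add (abs_nonneg _) (abs_nonneg _), abs_sub_comm (F z')]
          exact ENNReal.ofReal_le_ofReal (abs_sub_le _ _ _)
      _ ≤ ∫⁻ v in A, ({v | P z v}.indicator (fun v => ENNReal.ofReal |F z - F v|) v +
            {v | P z' v}.indicator (fun v => ENNReal.ofReal |F z' - F v|) v) ∂μ :=
          lintegral_mono_set fun v hv => hv.1
      _ = J z + J z' := by
          rw [lintegral_add_left (Measurable.indicator (by fun_prop) (hPz z))]
  refine ⟨F z', ?_⟩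
  calc m * ∫⁻ z in A, ENNReal.ofReal |F z - F z'| ∂μ
      = ∫⁻ z in A, m * ENNReal.ofReal |F z - F z'| ∂μ := by
        rw [lintegral_const_mul _ (by fun_prop)]
    _ ≤ ∫⁻ z in A, (J z + J z') ∂μ := setLIntegral_mono' hA hpt
    _ = ∫⁻ z in A, J z ∂μ + J z' * μ A := by
        rw [lintegral_add_left hJm, setLIntegral_const]
    _ ≤ ∫⁻ z in A, J z ∂μ + ∫⁻ z in A, J z ∂μ := by rw [mul_comm]; gcongr
    _ = 2 * ∫⁻ z in A, J z ∂μ := (two_mul _).symm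
    _ ≤ _ := by gcongr

/-- By convexity every pair in the ball may be joined directly, so the relation is taken to be
trivially true and `m` is the measure of the ball. -/
theorem exists_lintegral_ball_abs_sub_const_le (hF : Measurable F) (hg : Measurable g)
    (hN : μ N = 0) (hseg : ∀ x ∉ N, ∀ y ∉ N, ENNReal.ofReal |F x - F y| ≤
      ENNReal.ofReal ‖y - x‖ * ∫⁻ t in Icc (0 : ℝ) 1, g (x + t • (y - x)))
    (x : E) {r : ℝ} (hr : 0 < r) :
    ∃ c : ℝ, ∫⁻ z in ball x r, ENNReal.ofReal |F z - c| ∂μ ≤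
      2 ^ (Module.finrank ℝ E + 2) * ENNReal.ofReal r * ∫⁻ z in ball x r, g z ∂μ := by
  have h0 : μ (ball x r) ≠ 0 := (measure_ball_pos μ x hr).ne'
  have h1 : μ (ball x r) ≠ ∞ := measure_ball_lt_top.ne
  obtain ⟨c, hc⟩ := exists_lintegral_abs_sub_const_le μ (P := fun _ _ => True) (d := 2 * r)
    (D := ball x r) hF hg hN hseg measurableSet_ball measurableSet_ball h0 h1
    (fun z hz v hv => by
      rw [mem_ball_iff_norm] at hz hv
      calc ‖v - z‖ = ‖(v - x) - (z - x)‖ := by congr 1; abel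
        _ ≤ ‖v - x‖ + ‖z - x‖ := norm_sub_le _ _
        _ ≤ 2 * r := by linarith)
    (by simp)
    (fun z hz v hv _ t ht => (convex_ball x r).add_smul_sub_mem hz hv ht)
    (m := μ (ball x r)) (fun z _ v _ => by simp [ball])
  refine ⟨c, ?_⟩
  rw [← ENNReal.mul_le_mul_iff_right h0 h1]
  refine hc.trans_eq ?_
  rw [ENNReal.ofReal_mul two_pos.le, pow_add]
  simp only [ENNReal.ofReal_ofNat]
  ring

end Segments

/-! ### Poincaré inequality on a shell around the origin -/

section Shells

/-- The half-open spherical shell `{a ≤ |y| < b}` centred at the origin. -/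
def originShell (E : Type*) [NormedAddCommGroup E] (a b : ℝ) : Set E := {y | a ≤ ‖y‖ ∧ ‖y‖ < b}

theorem measurableSet_originShell {E : Type*} [NormedAddCommGroup E] [MeasurableSpace E]
    [BorelSpace E] (a b : ℝ) : MeasurableSet (originShell E a b) :=
  (measurableSet_le measurable_const measurable_norm).inter
    (measurableSet_lt measurable_norm measurable_const)

variable {E : Type*} [NormedAddCommGroup E] [InnerProductSpace ℝ E]

theorem exists_norm_eq_one_inner_nonneg [Nontrivial E] (x : E) :
    ∃ e : E, ‖e‖ = 1 ∧ 0 ≤ inner ℝ x e := by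
  obtain ⟨e, he⟩ := exists_norm_eq E zero_le_one
  rcases le_total 0 (inner ℝ x e) with h | h
  · exact ⟨e, he, h⟩
  · exact ⟨-e, by rwa [norm_neg], by rw [inner_neg_right]; linarith⟩

/-- A unit vector orthogonal to `x` exists in dimension at least 2, and its sign can be adjusted to
suit `y`. This is the point at which the argument fails on the line. -/
theorem exists_norm_eq_one_inner_nonneg_pair [FiniteDimensional ℝ E]
    (h2 : 2 ≤ Module.finrank ℝ E) (x y : E) :
    ∃ e : E, ‖e‖ = 1 ∧ 0 ≤ inner ℝ x e ∧ 0 ≤ inner ℝ y e := by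
  have h1 : Module.finrank ℝ (Submodule.span ℝ {x}) ≤ 1 := by
    simpa using finrank_span_le_card (R := ℝ) ({x} : Set E)
  have h3 := Submodule.finrank_add_finrank_orthogonal (Submodule.span ℝ {x})
  have h4 : 0 < Module.finrank ℝ (Submodule.span ℝ {x})ᗮ := by omega
  have := Module.nontrivial_of_finrank_pos h4
  obtain ⟨⟨e, he⟩, he1⟩ := exists_norm_eq (Submodule.span ℝ {x})ᗮ zero_le_one
  have hx : inner ℝ x e = 0 := Submodule.mem_orthogonal_singleton_iff_inner_right.1 he
  have he1' : ‖e‖ = 1 := he1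
  rcases le_total 0 (inner ℝ y e) with h | h
  · exact ⟨e, he1', hx.ge, h⟩
  · exact ⟨-e, by rwa [norm_neg], by rw [inner_neg_right]; linarith,
      by rw [inner_neg_right]; linarith⟩

/-- The hypothesis says that the angle is at most 120°. With `a = (1 - t)‖z‖` and `b = t‖v‖`, the
squared norm is at least `a² - ab + b² ≥ (a + b)² / 4`, and `a + b ≥ R`. -/
theorem half_le_norm_segment {z v : E} {R t : ℝ} (hR : 0 < R) (hz : R ≤ ‖z‖) (hv : R ≤ ‖v‖)
    (h : -(‖z‖ * ‖v‖) / 2 ≤ inner ℝ z v) (ht : t ∈ Icc (0 : ℝ) 1) :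
    R / 2 ≤ ‖z + t • (v - z)‖ := by
  have hform : z + t • (v - z) = (1 - t) • z + t • v := by
    rw [smul_sub, sub_smul, one_smul]; abel
  have h1 : 0 ≤ 1 - t := by linarith [ht.2]
  have h0 : 0 ≤ t := ht.1
  have hsq : ‖z + t • (v - z)‖ ^ 2 =
      ((1 - t) * ‖z‖) ^ 2 + 2 * ((1 - t) * t * inner ℝ z v) + (t * ‖v‖) ^ 2 := by
    rw [hform, norm_add_sq_real, norm_smul, norm_smul, inner_smul_left, inner_smul_right,
      Real.norm_of_nonneg h0, Real.norm_of_nonneg h1]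
    simp; ring
  have ha : (1 - t) * R ≤ (1 - t) * ‖z‖ := by gcongr
  have hb : t * R ≤ t * ‖v‖ := by gcongr
  have hc : (1 - t) * t * (-(‖z‖ * ‖v‖) / 2) ≤ (1 - t) * t * inner ℝ z v := by gcongr
  have hsum : R ≤ (1 - t) * ‖z‖ + t * ‖v‖ := by linarith
  refine abs_le_of_sq_le_sq' ?_ (norm_nonneg _) |>.2
  rw [hsq]
  nlinarith [sq_nonneg ((1 - t) * ‖z‖ - t * ‖v‖)]

variable [MeasurableSpace E] [BorelSpace E] [FiniteDimensional ℝ E]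
  (μ : Measure E) [μ.IsAddHaarMeasure]
  {F : E → ℝ} {g : E → ℝ≥0∞} {N : Set E}

theorem exists_lintegral_originShell_abs_sub_const_le (h2 : 2 ≤ Module.finrank ℝ E)
    (hF : Measurable F) (hg : Measurable g)
    (hN : μ N = 0) (hseg : ∀ x ∉ N, ∀ y ∉ N, ENNReal.ofReal |F x - F y| ≤
      ENNReal.ofReal ‖y - x‖ * ∫⁻ t in Icc (0 : ℝ) 1, g (x + t • (y - x)))
    {R : ℝ} (hR : 0 < R) :
    ∃ c : ℝ, ∫⁻ z in originShell E R (2 * R), ENNReal.ofReal |F z - c| ∂μ ≤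
      8 ^ (Module.finrank ℝ E + 1) * ENNReal.ofReal R *
        ∫⁻ z in originShell E (R / 2) (2 * R), g z ∂μ := by
  have hnt : Nontrivial E := Module.nontrivial_of_finrank_pos (R := ℝ) (by omega)
  set m := μ (ball (0 : E) (R / 2)) with hm
  have hm0 : m ≠ 0 := (measure_ball_pos μ _ (by positivity)).ne'
  have hmtop : m ≠ ∞ := measure_ball_lt_top.ne
  have hsub : originShell E R (2 * R) ⊆ ball 0 (4 * (R / 2)) := fun y hy => by
    rw [mem_ball_zero_iff]; linarith [hy.2]
  have hupper : μ (originShell E R (2 * R)) ≤ 4 ^ Module.finrank ℝ E * m := by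
    refine (measure_mono hsub).trans_eq ?_
    rw [Measure.addHaar_ball_mul μ 0 (by norm_num), ENNReal.ofReal_pow (by norm_num)]
    simp [hm]
  have hlower : ∀ z ∈ originShell E R (2 * R), ∀ z' ∈ originShell E R (2 * R),
      m ≤ μ {v ∈ originShell E R (2 * R) | -(‖z‖ * ‖v‖) / 2 ≤ inner ℝ z v ∧
        -(‖z'‖ * ‖v‖) / 2 ≤ inner ℝ z' v} := by
    intro z _ z' _
    -- The ball of radius `R/2` about `(3/2)R e` lies in the shell and consists of common
    -- neighbours: `v` differs from a nonnegative multiple of `e` by less than `R/2 ≤ ‖v‖/2`, so its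
    -- inner product with `z` or `z'` is at least minus half the product of the norms.
    obtain ⟨e, he, h3, h4⟩ := exists_norm_eq_one_inner_nonneg_pair h2 z z'
    have hmb : m = μ (ball ((3 / 2 * R) • e) (R / 2)) := by
      rw [hm, Measure.addHaar_ball_center μ ((3 / 2 * R) • e)]
    rw [hmb]
    refine measure_mono fun v hv => ?_
    rw [mem_ball_iff_norm] at hv
    have hne : ‖(3 / 2 * R) • e‖ = 3 / 2 * R := by
      rw [norm_smul, he, mul_one, Real.norm_of_nonneg (by positivity)]
    have hv1 : R ≤ ‖v‖ := by
      have := norm_sub_norm_le ((3 / 2 * R) • e) v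
      rw [norm_sub_rev] at this
      linarith
    have hv2 : ‖v‖ < 2 * R := by
      have := norm_sub_norm_le v ((3 / 2 * R) • e)
      linarith
    have key : ∀ u : E, 0 ≤ inner ℝ u e → -(‖u‖ * ‖v‖) / 2 ≤ inner ℝ u v := by
      intro u hu
      have h5 : inner ℝ u v = 3 / 2 * R * inner ℝ u e + inner ℝ u (v - (3 / 2 * R) • e) := by
        rw [inner_sub_right, inner_smul_right]; ring
      have h6 := neg_le_of_abs_le (abs_real_inner_le_norm u (v - (3 / 2 * R) • e))
      have h7 : ‖u‖ * ‖v - (3 / 2 * R) • e‖ ≤ ‖u‖ * (‖v‖ / 2) := by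
        gcongr; linarith
      have h8 : 0 ≤ 3 / 2 * R * inner ℝ u e := by positivity
      rw [h5]; linarith
    exact ⟨⟨hv1, hv2⟩, key z h3, key z' h4⟩
  have hS0 : μ (originShell E R (2 * R)) ≠ 0 := by
    obtain ⟨z, hz⟩ := exists_norm_eq E hR.le
    have hzS : z ∈ originShell E R (2 * R) := ⟨hz.ge, by linarith⟩
    exact fun h => hm0 (le_antisymm ((hlower z hzS z hzS).trans
      ((measure_mono fun v hv => hv.1).trans h.le)) zero_le)
  obtain ⟨c, hc⟩ := exists_lintegral_abs_sub_const_le μ (d := 4 * R)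
    (P := fun z v => -(‖z‖ * ‖v‖) / 2 ≤ inner ℝ z v) (D := originShell E (R / 2) (2 * R))
    hF hg hN hseg (measurableSet_originShell _ _) (measurableSet_originShell _ _) hS0
    (ne_top_of_le_ne_top (ENNReal.mul_ne_top (by simp) hmtop) hupper)
    (fun z hz v hv => (norm_sub_le _ _).trans (by linarith [hz.2, hv.2]))
    (measurableSet_le (by fun_prop) (by fun_prop))
    (fun z hz v hv hP t ht => ⟨half_le_norm_segment hR hz.1 hv.1 hP ht, by
      have := (convex_ball (0 : E) (2 * R)).add_smul_sub_mem (mem_ball_zero_iff.2 hz.2)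
        (mem_ball_zero_iff.2 hv.2) ht
      exact mem_ball_zero_iff.1 this⟩) hlower
  refine ⟨c, ?_⟩
  rw [← ENNReal.mul_le_mul_iff_right hm0 hmtop]
  refine hc.trans ?_
  calc _ ≤ 2 * (ENNReal.ofReal (4 * R) * (2 ^ Module.finrank ℝ E * (4 ^ Module.finrank ℝ E * m) *
        ∫⁻ x in originShell E (R / 2) (2 * R), g x ∂μ)) := by gcongr
    _ = _ := by
      rw [ENNReal.ofReal_mul (by norm_num), pow_succ, show (8 : ℝ≥0∞) = 2 * 4 by norm_num, mul_pow]
      simp only [ENNReal.ofReal_ofNat]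
      ring

end Shells

/-! ### Transport along rays from a ball to the surrounding shell -/

section Radial

variable {E : Type*} [NormedAddCommGroup E] [NormedSpace ℝ E]

theorem smul_mem_originShell_iff {x : E} (hx : x ≠ 0) {R s : ℝ} (hs : 0 < s) :
    s • x ∈ originShell E R (2 * R) ↔ s ∈ Ico (R / ‖x‖) (2 * (R / ‖x‖)) := by
  have hx' : 0 < ‖x‖ := norm_pos_iff.2 hx
  simp only [originShell, mem_ofPred_eq, mem_Ico, norm_smul, Real.norm_of_nonneg hs.le,
    div_le_iff₀ hx', ← mul_div_assoc, lt_div_iff₀ hx']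

/-- The ray through `x` is in the shell for `s ∈ [a, 2a)`, `a = R/‖x‖`, so the integral is `log 2`.
The crude bounds 1/2 here and 1 in `lintegral_ray_le_one` suffice and avoid the logarithm. -/
theorem half_le_lintegral_ray {x : E} (hx : x ≠ 0) {R : ℝ} (hxR : ‖x‖ < R) :
    2⁻¹ ≤ ∫⁻ s in Ioi (1 : ℝ),
      ENNReal.ofReal s⁻¹ * (originShell E R (2 * R)).indicator 1 (s • x) := by
  have hx' : 0 < ‖x‖ := norm_pos_iff.2 hx
  have ha : 1 < R / ‖x‖ := (one_lt_div hx').2 hxR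
  set a := R / ‖x‖ with ha'
  have ha0 : 0 < a := by linarith
  have hsub : Ico a (2 * a) ⊆ Ioi 1 := fun s hs => ha.trans_le hs.1
  calc (2 : ℝ≥0∞)⁻¹ = ∫⁻ s in Ico a (2 * a), ENNReal.ofReal (2 * a)⁻¹ := by
        rw [setLIntegral_const, Real.volume_Ico, ← ENNReal.ofReal_mul (by positivity),
          show (2 * a)⁻¹ * (2 * a - a) = 2⁻¹ by field_simp; ring,
          ENNReal.ofReal_inv_of_pos two_pos]
        simp
    _ ≤ ∫⁻ s in Ico a (2 * a),
          ENNReal.ofReal s⁻¹ * (originShell E R (2 * R)).indicator 1 (s • x) := by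
        refine setLIntegral_mono' measurableSet_Ico fun s hs => ?_
        have hs0 : 0 < s := ha0.trans_le hs.1
        rw [indicator_of_mem ((smul_mem_originShell_iff hx hs0).2 hs), Pi.one_apply, mul_one]
        gcongr
        exact hs.2.le
    _ ≤ _ := lintegral_mono_set hsub

theorem lintegral_ray_le_one {x : E} (hx : x ≠ 0) {R : ℝ} (hxR : ‖x‖ < R) :
    ∫⁻ s in Ioi (1 : ℝ),
      ENNReal.ofReal s⁻¹ * (originShell E R (2 * R)).indicator 1 (s • x) ≤ 1 := by
  have hx' : 0 < ‖x‖ := norm_pos_iff.2 hx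
  have ha : 1 < R / ‖x‖ := (one_lt_div hx').2 hxR
  set a := R / ‖x‖ with ha'
  have ha0 : 0 < a := by linarith
  calc _ ≤ ∫⁻ s in Ioi (1 : ℝ), (Ico a (2 * a)).indicator (fun _ => ENNReal.ofReal a⁻¹) s := by
        refine setLIntegral_mono' measurableSet_Ioi fun s hs => ?_
        have hs0 : 0 < s := one_pos.trans hs
        by_cases h : s ∈ Ico a (2 * a)
        · rw [indicator_of_mem ((smul_mem_originShell_iff hx hs0).2 h), indicator_of_mem h,
            Pi.one_apply, mul_one]
          gcongr
          exact h.1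
        · rw [indicator_of_notMem fun h' => h ((smul_mem_originShell_iff hx hs0).1 h')]
          simp
    _ ≤ ∫⁻ s, (Ico a (2 * a)).indicator (fun _ => ENNReal.ofReal a⁻¹) s :=
        setLIntegral_le_lintegral _ _
    _ = 1 := by
        rw [lintegral_indicator measurableSet_Ico, setLIntegral_const, Real.volume_Ico,
          ← ENNReal.ofReal_mul (by positivity),
          show a⁻¹ * (2 * a - a) = 1 by field_simp; ring, ENNReal.ofReal_one]

/-- Arc length along the ray is `‖x‖ dτ = τ⁻¹ ‖τ x‖ dτ`, which puts the line integral into the form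
of a dilation average, of the function `‖y‖ g(y)` on the ball. -/
theorem segment_smul_le_lintegral_ray (g : E → ℝ≥0∞) {x : E} {R s : ℝ} (hs : 1 < s)
    (hsR : s * ‖x‖ < 2 * R) :
    ENNReal.ofReal ‖s • x - x‖ * ∫⁻ t in Icc (0 : ℝ) 1, g (x + t • (s • x - x)) ≤
      ∫⁻ τ in Ioi (1 : ℝ), ENNReal.ofReal τ⁻¹ *
        (ball (0 : E) (2 * R)).indicator (fun y => ENNReal.ofReal ‖y‖ * g y) (τ • x) := by
  have hs1 : 0 < s - 1 := by linarith
  have h1 := setLIntegral_Icc_comp_affine (fun τ => g (τ • x)) 1 (c := 1) hs1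
  have hform : s • x - x = (s - 1) • x := by rw [sub_smul, one_smul]
  have h2 : ∀ t : ℝ, x + t • (s • x - x) = (1 + (s - 1) * t) • x := fun t => by
    rw [hform, add_smul, one_smul, smul_smul, mul_comm]
  simp_rw [h2]
  rw [hform, norm_smul, Real.norm_of_nonneg hs1.le, mul_comm (s - 1), ENNReal.ofReal_mul
    (norm_nonneg _), mul_assoc, h1, mul_one, add_sub_cancel, ← setLIntegral_congr Ioc_ae_eq_Icc,
    ← lintegral_const_mul' _ _ ENNReal.ofReal_ne_top]
  refine le_trans (setLIntegral_mono' measurableSet_Ioc fun τ hτ => ?_)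
    (lintegral_mono_set Ioc_subset_Ioi_self)
  have hτ0 : 0 < τ := one_pos.trans hτ.1
  have hn : ‖τ • x‖ = τ * ‖x‖ := by rw [norm_smul, Real.norm_of_nonneg hτ0.le]
  have hmem : τ • x ∈ ball (0 : E) (2 * R) := by
    rw [mem_ball_zero_iff, hn]
    exact lt_of_le_of_lt (by gcongr; exact hτ.2) hsR
  rw [indicator_of_mem hmem, hn, ← mul_assoc, ← ENNReal.ofReal_mul (by positivity),
    inv_mul_cancel_left₀ hτ0.ne']

/-- The triangle inequality through `F (s • x)` is averaged over the `s` that place `s • x` in the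
shell. The infinite term on `N` makes the bound trivial where the segment inequality is unavailable;
it disappears upon integration, since `N` will be a null set. -/
theorem half_abs_sub_const_le_lintegral_ray {F : E → ℝ} {g : E → ℝ≥0∞} {N : Set E}
    [MeasurableSpace E] [BorelSpace E]
    (hF : Measurable F) (hNm : MeasurableSet N)
    (hseg : ∀ x ∉ N, ∀ y ∉ N, ENNReal.ofReal |F x - F y| ≤
      ENNReal.ofReal ‖y - x‖ * ∫⁻ t in Icc (0 : ℝ) 1, g (x + t • (y - x)))
    (c : ℝ) {x : E} (hx : x ≠ 0) (hxN : x ∉ N) {R : ℝ} (hxR : ‖x‖ < R) :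
    2⁻¹ * ENNReal.ofReal |F x - c| ≤
      (∫⁻ s in Ioi (1 : ℝ), ENNReal.ofReal s⁻¹ *
        ((originShell E R (2 * R)).indicator (fun y => ENNReal.ofReal |F y - c|) (s • x) +
          N.indicator (fun _ => ∞) (s • x))) +
      ∫⁻ τ in Ioi (1 : ℝ), ENNReal.ofReal τ⁻¹ *
        (ball (0 : E) (2 * R)).indicator (fun y => ENNReal.ofReal ‖y‖ * g y) (τ • x) := by
  set G := ∫⁻ τ in Ioi (1 : ℝ), ENNReal.ofReal τ⁻¹ *
        (ball (0 : E) (2 * R)).indicator (fun y => ENNReal.ofReal ‖y‖ * g y) (τ • x) with hG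
  have hS := measurableSet_originShell (E := E) R (2 * R)
  have hm1 : Measurable fun s : ℝ => ENNReal.ofReal s⁻¹ *
      (originShell E R (2 * R)).indicator (1 : E → ℝ≥0∞) (s • x) := by
    have : Measurable fun s : ℝ => (originShell E R (2 * R)).indicator (1 : E → ℝ≥0∞) (s • x) :=
      (measurable_one.indicator hS).comp (by fun_prop)
    fun_prop
  have hm2 : Measurable fun s : ℝ => ENNReal.ofReal s⁻¹ *
        ((originShell E R (2 * R)).indicator (fun y => ENNReal.ofReal |F y - c|) (s • x) +
          N.indicator (fun _ => ∞) (s • x)) := by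
    have h1 : Measurable fun s : ℝ => (originShell E R (2 * R)).indicator
        (fun y => ENNReal.ofReal |F y - c|) (s • x) :=
      (Measurable.indicator (by fun_prop) hS).comp (by fun_prop)
    have h2 : Measurable fun s : ℝ => N.indicator (fun _ => ∞) (s • x) :=
      (measurable_const.indicator hNm).comp (by fun_prop)
    fun_prop
  calc 2⁻¹ * ENNReal.ofReal |F x - c|
      ≤ (∫⁻ s in Ioi (1 : ℝ), ENNReal.ofReal s⁻¹ *
          (originShell E R (2 * R)).indicator 1 (s • x)) * ENNReal.ofReal |F x - c| := by
        gcongr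
        exact half_le_lintegral_ray hx hxR
    _ = ∫⁻ s in Ioi (1 : ℝ), ENNReal.ofReal s⁻¹ *
          (originShell E R (2 * R)).indicator 1 (s • x) * ENNReal.ofReal |F x - c| :=
        (lintegral_mul_const _ hm1).symm
    _ ≤ ∫⁻ s in Ioi (1 : ℝ), (ENNReal.ofReal s⁻¹ *
        ((originShell E R (2 * R)).indicator (fun y => ENNReal.ofReal |F y - c|) (s • x) +
          N.indicator (fun _ => ∞) (s • x)) +
        ENNReal.ofReal s⁻¹ * (originShell E R (2 * R)).indicator 1 (s • x) * G) := by
        refine setLIntegral_mono' measurableSet_Ioi fun s hs => ?_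
        have hs1 : 1 < s := hs
        by_cases h : s • x ∈ originShell E R (2 * R)
        · rw [indicator_of_mem h, indicator_of_mem h, Pi.one_apply, mul_one, ← mul_add]
          gcongr
          by_cases hsN : s • x ∈ N
          · simp [indicator_of_mem hsN]
          · rw [indicator_of_notMem hsN, add_zero]
            calc ENNReal.ofReal |F x - c|
                ≤ ENNReal.ofReal |F (s • x) - c| + ENNReal.ofReal |F x - F (s • x)| := by
                  rw [← ENNReal.ofReal_add (abs_nonneg _) (abs_nonneg _), add_comm]
                  exact ENNReal.ofReal_le_ofReal (abs_sub_le _ _ _)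
              _ ≤ _ := by
                  gcongr
                  refine (hseg x hxN _ hsN).trans (segment_smul_le_lintegral_ray g hs1 ?_)
                  have := h.2
                  rwa [norm_smul, Real.norm_of_nonneg (by linarith)] at this
        · rw [indicator_of_notMem h]
          simp
    _ = _ + (∫⁻ s in Ioi (1 : ℝ), ENNReal.ofReal s⁻¹ *
          (originShell E R (2 * R)).indicator 1 (s • x)) * G := by
        rw [lintegral_add_left hm2, lintegral_mul_const _ hm1]
    _ ≤ _ := by
        gcongr
        exact (mul_le_mul_left (lintegral_ray_le_one hx hxR) _).trans_eq (one_mul _)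

end Radial

/-! ### Balls at the origin, local integrability and doubling -/

theorem weightMeasure_absolutelyContinuous {n : ℕ} (w : EuclideanSpace ℝ (Fin n) → ℝ) :
    weightMeasure w ≪ volume := withDensity_absolutelyContinuous _ _

theorem exists_lintegral_ball_zero_abs_sub_const_le {n : ℕ} (hn : 0 < n) {α : ℝ} (β : ℝ)
    (hα : -(n : ℝ) < α) :
    ∃ C : ℝ≥0∞, C ≠ ∞ ∧ ∀ (F : EuclideanSpace ℝ (Fin n) → ℝ)
      (g : EuclideanSpace ℝ (Fin n) → ℝ≥0∞) (N : Set (EuclideanSpace ℝ (Fin n))),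
      Measurable F → Measurable g → MeasurableSet N → volume N = 0 →
      (∀ x ∉ N, ∀ y ∉ N, ENNReal.ofReal |F x - F y| ≤
        ENNReal.ofReal ‖y - x‖ * ∫⁻ t in Icc (0 : ℝ) 1, g (x + t • (y - x))) →
      ∀ (c R : ℝ),
        ∫⁻ x in ball 0 R, ENNReal.ofReal |F x - c| ∂weightMeasure (logPowerWeight n α β) ≤
          C * (∫⁻ x in originShell _ R (2 * R), ENNReal.ofReal |F x - c|
              ∂weightMeasure (logPowerWeight n α β) +
            ENNReal.ofReal (2 * R) *
              ∫⁻ x in ball 0 (2 * R), g x ∂weightMeasure (logPowerWeight n α β)) := by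
  have : Nonempty (Fin n) := ⟨⟨0, hn⟩⟩
  obtain ⟨C, hC, hle⟩ := exists_lintegral_radial_le hn β hα
  refine ⟨2 * C, ENNReal.mul_ne_top (by simp) hC, fun F g N hF hg hNm hN hseg c R => ?_⟩
  have hac := weightMeasure_absolutelyContinuous (logPowerWeight n α β)
  set μ := weightMeasure (logPowerWeight n α β) with hμ
  have : SFinite μ := by rw [hμ]; unfold weightMeasure; infer_instance
  have hS := measurableSet_originShell (E := EuclideanSpace ℝ (Fin n)) R (2 * R)
  set H₁ : EuclideanSpace ℝ (Fin n) → ℝ≥0∞ := fun y =>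
    (originShell _ R (2 * R)).indicator (fun y => ENNReal.ofReal |F y - c|) y +
      N.indicator (fun _ => ∞) y with hH₁
  set H₂ : EuclideanSpace ℝ (Fin n) → ℝ≥0∞ :=
    (ball 0 (2 * R)).indicator (fun y => ENNReal.ofReal ‖y‖ * g y) with hH₂
  have hm₁ : Measurable H₁ :=
    (Measurable.indicator (by fun_prop) hS).add (measurable_const.indicator hNm)
  have hm₂ : Measurable H₂ := Measurable.indicator (by fun_prop) measurableSet_ball
  have hI₁ : ∫⁻ x, H₁ x ∂μ = ∫⁻ x in originShell _ R (2 * R), ENNReal.ofReal |F x - c| ∂μ := by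
    rw [hH₁, lintegral_add_left (Measurable.indicator (by fun_prop) hS), lintegral_indicator hS,
      lintegral_indicator hNm, setLIntegral_const, hac hN, mul_zero, add_zero]
  have hI₂ : ∫⁻ x, H₂ x ∂μ ≤ ENNReal.ofReal (2 * R) * ∫⁻ x in ball 0 (2 * R), g x ∂μ := by
    rw [hH₂, lintegral_indicator measurableSet_ball, ← lintegral_const_mul _ hg]
    refine setLIntegral_mono' measurableSet_ball fun y hy => ?_
    gcongr
    exact (mem_ball_zero_iff.1 hy).le
  have hpt : ∀ᵐ x ∂μ.restrict (ball 0 R), 2⁻¹ * ENNReal.ofReal |F x - c| ≤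
      (∫⁻ s in Ioi (1 : ℝ), ENNReal.ofReal s⁻¹ * H₁ (s • x)) +
        ∫⁻ s in Ioi (1 : ℝ), ENNReal.ofReal s⁻¹ * H₂ (s • x) := by
    filter_upwards [ae_restrict_mem measurableSet_ball,
      ae_restrict_of_ae (compl_mem_ae_iff.2 (hac hN)),
      ae_restrict_of_ae (compl_mem_ae_iff.2
        (hac (measure_singleton (0 : EuclideanSpace ℝ (Fin n)))))] with x h1 h2 h3
    exact half_abs_sub_const_le_lintegral_ray hF hNm hseg c h3 h2 (mem_ball_zero_iff.1 h1)
  have hmR : ∀ H : EuclideanSpace ℝ (Fin n) → ℝ≥0∞, Measurable H →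
      Measurable fun x => ∫⁻ s in Ioi (1 : ℝ), ENNReal.ofReal s⁻¹ * H (s • x) := by
    intro H hH
    exact Measurable.lintegral_prod_right' (f := fun p : EuclideanSpace ℝ (Fin n) × ℝ =>
      ENNReal.ofReal p.2⁻¹ * H (p.2 • p.1)) (by fun_prop)
  calc ∫⁻ x in ball 0 R, ENNReal.ofReal |F x - c| ∂μ
      = 2 * ∫⁻ x in ball 0 R, 2⁻¹ * ENNReal.ofReal |F x - c| ∂μ := by
        rw [lintegral_const_mul' _ _ (by simp), ← mul_assoc,
          ENNReal.mul_inv_cancel (by simp) (by simp), one_mul]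
    _ ≤ 2 * ∫⁻ x in ball 0 R, ((∫⁻ s in Ioi (1 : ℝ), ENNReal.ofReal s⁻¹ * H₁ (s • x)) +
        ∫⁻ s in Ioi (1 : ℝ), ENNReal.ofReal s⁻¹ * H₂ (s • x)) ∂μ := by
        gcongr 2 * ?_
        exact lintegral_mono_ae hpt
    _ ≤ 2 * ∫⁻ x, ((∫⁻ s in Ioi (1 : ℝ), ENNReal.ofReal s⁻¹ * H₁ (s • x)) +
        ∫⁻ s in Ioi (1 : ℝ), ENNReal.ofReal s⁻¹ * H₂ (s • x)) ∂μ := by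
        gcongr 2 * ?_
        exact setLIntegral_le_lintegral _ _
    _ ≤ 2 * (C * ∫⁻ x, H₁ x ∂μ + C * ∫⁻ x, H₂ x ∂μ) := by
        rw [lintegral_add_left (hmR H₁ hm₁)]
        gcongr
        · exact hle H₁ hm₁
        · exact hle H₂ hm₂
    _ ≤ 2 * (C * ∫⁻ x in originShell _ R (2 * R), ENNReal.ofReal |F x - c| ∂μ +
          C * (ENNReal.ofReal (2 * R) * ∫⁻ x in ball 0 (2 * R), g x ∂μ)) := by
        rw [hI₁]; gcongr
    _ = _ := by ring

/-- This is the ray estimate for the constant function 1 with `c = 0` and zero gradient. -/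
theorem exists_weightMeasure_ball_zero_le {n : ℕ} (hn : 0 < n) {α : ℝ} (β : ℝ)
    (hα : -(n : ℝ) < α) :
    ∃ C : ℝ≥0∞, C ≠ ∞ ∧ ∀ R : ℝ, weightMeasure (logPowerWeight n α β) (ball 0 R) ≤
      C * weightMeasure (logPowerWeight n α β) (originShell _ R (2 * R)) := by
  obtain ⟨C, hC, hle⟩ := exists_lintegral_ball_zero_abs_sub_const_le hn β hα
  refine ⟨C, hC, fun R => ?_⟩
  simpa using hle (fun _ => 1) 0 ∅ measurable_const measurable_zero .empty measure_empty
    (by simp) 0 R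

theorem exists_weightMeasure_comparable (n : ℕ) (α β : ℝ) {K : ℝ} (hK : 1 ≤ K) :
    ∃ C : ℝ≥0∞, C ≠ ∞ ∧ ∀ (ρ : ℝ) (A : Set (EuclideanSpace ℝ (Fin n))), 0 < ρ → MeasurableSet A →
      (∀ y ∈ A, ρ ≤ K * ‖y‖ ∧ ‖y‖ ≤ K * ρ) →
        weightMeasure (logPowerWeight n α β) A ≤
          C * (ENNReal.ofReal (logPowerProfile α β ρ) * volume A) ∧
        ENNReal.ofReal (logPowerProfile α β ρ) * volume A ≤
          C * weightMeasure (logPowerWeight n α β) A := by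
  obtain ⟨C, -, h⟩ := exists_setLIntegral_weightMeasure_comparable n α β hK
  refine ⟨ENNReal.ofReal C, ENNReal.ofReal_ne_top, fun ρ A hρ hA hy => ?_⟩
  have := h ρ A hρ hA hy 1 measurable_one
  simpa [mul_assoc] using this

theorem originShell_subset_ball (E : Type*) [NormedAddCommGroup E] (a b : ℝ) :
    originShell E a b ⊆ ball 0 b := fun _ hy => mem_ball_zero_iff.2 hy.2

theorem weightMeasure_ball_zero_lt_top {n : ℕ} (hn : 0 < n) {α : ℝ} (β : ℝ)
    (hα : -(n : ℝ) < α) {R : ℝ} (hR : 0 < R) :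
    weightMeasure (logPowerWeight n α β) (ball 0 R) < ∞ := by
  obtain ⟨C₁, hC₁, h₁⟩ := exists_weightMeasure_ball_zero_le hn β hα
  obtain ⟨C₂, hC₂, h₂⟩ := exists_weightMeasure_comparable n α β one_le_two
  refine ((h₁ R).trans (mul_le_mul_right (h₂ R _ hR (measurableSet_originShell R (2 * R))
    fun y hy => ⟨by linarith [hy.1], hy.2.le⟩).1 _)).trans_lt ?_
  refine ENNReal.mul_lt_top hC₁.lt_top (ENNReal.mul_lt_top hC₂.lt_top
    (ENNReal.mul_lt_top ENNReal.ofReal_lt_top ?_))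
  exact (measure_mono (originShell_subset_ball _ _ _)).trans_lt measure_ball_lt_top

theorem weightMeasure_ball_lt_top {n : ℕ} (hn : 0 < n) {α : ℝ} (β : ℝ)
    (hα : -(n : ℝ) < α) (x : EuclideanSpace ℝ (Fin n)) (r : ℝ) :
    weightMeasure (logPowerWeight n α β) (ball x r) < ∞ := by
  have hsub : ball x r ⊆ ball 0 (‖x‖ + |r| + 1) := ball_subset_ball' (by
    rw [dist_zero_right]; linarith [le_abs_self r])
  exact (measure_mono hsub).trans_lt (weightMeasure_ball_zero_lt_top hn β hα (by positivity))

theorem isWeight_logPowerWeight {n : ℕ} (hn : 0 < n) {α : ℝ} (β : ℝ) (hα : -(n : ℝ) < α) :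
    IsWeight (logPowerWeight n α β) := by
  refine ⟨logPowerWeight_nonneg n α β, fun x => ⟨ball x 1, ball_mem_nhds x one_pos,
    (measurable_logPowerWeight n α β).aestronglyMeasurable, ?_⟩⟩
  have h := weightMeasure_ball_lt_top hn β hα x 1
  rw [weightMeasure, withDensity_apply _ measurableSet_ball] at h
  rw [hasFiniteIntegral_iff_enorm]
  simpa only [Real.enorm_of_nonneg (logPowerWeight_nonneg n α β _)] using h

theorem ball_subset_far {n : ℕ} {x y : EuclideanSpace ℝ (Fin n)} {r : ℝ} (hx : 2 * r ≤ ‖x‖)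
    (hy : y ∈ ball x r) : ‖x‖ ≤ 2 * ‖y‖ ∧ ‖y‖ ≤ 2 * ‖x‖ := by
  rw [mem_ball_iff_norm] at hy
  have h1 := norm_sub_norm_le y x
  have h2 := norm_sub_norm_le x y
  rw [norm_sub_rev] at h2
  have := norm_nonneg (y - x)
  constructor <;> linarith

theorem exists_weightMeasure_doubling {n : ℕ} (hn : 0 < n) {α : ℝ} (β : ℝ)
    (hα : -(n : ℝ) < α) :
    ∃ D : ℝ≥0∞, D ≠ ∞ ∧ ∀ (x : EuclideanSpace ℝ (Fin n)) (r : ℝ), 0 < r →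
      0 < weightMeasure (logPowerWeight n α β) (ball x r) ∧
      weightMeasure (logPowerWeight n α β) (ball x (2 * r)) ≤
        D * weightMeasure (logPowerWeight n α β) (ball x r) := by
  have : Nonempty (Fin n) := ⟨⟨0, hn⟩⟩
  obtain ⟨C₁, hC₁, h₁⟩ := exists_weightMeasure_ball_zero_le hn β hα
  obtain ⟨C₂, hC₂, h₂⟩ := exists_weightMeasure_comparable n α β (K := 12) (by norm_num)
  set μ := weightMeasure (logPowerWeight n α β)
  have hpos : ∀ (ρ : ℝ) (A : Set (EuclideanSpace ℝ (Fin n))), 0 < ρ → 0 < volume A →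
      ENNReal.ofReal (logPowerProfile α β ρ) * volume A ≤ C₂ * μ A → 0 < μ A := by
    intro ρ A hρ hA h
    by_contra! h0
    rw [nonpos_iff_eq_zero.1 h0, mul_zero, nonpos_iff_eq_zero, mul_eq_zero,
      ENNReal.ofReal_eq_zero] at h
    exact h.elim (fun h => (logPowerProfile_pos α β hρ).not_ge h) hA.ne'
  refine ⟨C₁ * C₂ * C₂ * 48 ^ n + C₂ * C₂ * 2 ^ n, ?_, fun x r hr => ?_⟩
  · finiteness
  rcases lt_or_ge ‖x‖ (4 * r) with hx | hx
  · obtain ⟨e, he, hxe⟩ := exists_norm_eq_one_inner_nonneg x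
    set x' := x + (r / 2) • e with hx'
    have hx'x : ‖x' - x‖ = r / 2 := by
      rw [hx', add_sub_cancel_left, norm_smul, he, mul_one, Real.norm_of_nonneg (by positivity)]
    have hx'1 : r / 2 ≤ ‖x'‖ := by
      have h3 : inner ℝ x' e = inner ℝ x e + r / 2 := by
        rw [hx', inner_add_left, inner_smul_left, real_inner_self_eq_norm_sq, he]; simp
      have h4 := real_inner_le_norm x' e
      rw [he, mul_one] at h4
      linarith
    have hsub : ball x' (r / 4) ⊆ ball x r := ball_subset_ball' (by
      rw [dist_eq_norm, hx'x]; linarith)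
    have hlow := (h₂ r (ball x' (r / 4)) hr measurableSet_ball fun y hy => by
      have h5 := mem_ball_iff_norm.1 (hsub hy)
      have h6 := norm_sub_norm_le y x
      have h7 := norm_sub_norm_le x' y
      rw [mem_ball_iff_norm'] at hy
      constructor <;> linarith).2
    have hupp := (h₂ r (originShell _ (6 * r) (2 * (6 * r))) hr (measurableSet_originShell _ _)
      fun y hy => by constructor <;> linarith [hy.1, hy.2]).1
    have hvol : volume (originShell (EuclideanSpace ℝ (Fin n)) (6 * r) (2 * (6 * r))) ≤
        48 ^ n * volume (ball x' (r / 4)) := by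
      refine (measure_mono (originShell_subset_ball _ _ _)).trans_eq ?_
      rw [show 2 * (6 * r) = 48 * (r / 4) by ring, Measure.addHaar_ball_mul volume _ (by norm_num),
        Measure.addHaar_ball_center volume x', ENNReal.ofReal_pow (by norm_num)]
      simp
    refine ⟨(hpos r _ hr (measure_ball_pos _ _ (by positivity)) hlow).trans_le
      (measure_mono hsub), ?_⟩
    calc μ (ball x (2 * r)) ≤ μ (ball 0 (6 * r)) := measure_mono (ball_subset_ball' (by
          rw [dist_zero_right]; linarith))
      _ ≤ C₁ * (C₂ * (ENNReal.ofReal (logPowerProfile α β r) *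
            (48 ^ n * volume (ball x' (r / 4))))) :=
          (h₁ _).trans (by gcongr; exact hupp.trans (by gcongr))
      _ = C₁ * C₂ * 48 ^ n * (ENNReal.ofReal (logPowerProfile α β r) *
            volume (ball x' (r / 4))) := by ring
      _ ≤ C₁ * C₂ * 48 ^ n * (C₂ * μ (ball x r)) := by
          exact mul_le_mul_right (hlow.trans (mul_le_mul_right (measure_mono hsub) _)) _
      _ = (C₁ * C₂ * C₂ * 48 ^ n) * μ (ball x r) := by ring
      _ ≤ _ := by gcongr; exact le_self_add
  · have hx0 : 0 < ‖x‖ := by linarith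
    have hlow := (h₂ ‖x‖ (ball x r) hx0 measurableSet_ball fun y hy => by
      have := ball_subset_far (by linarith) hy
      have := norm_nonneg y
      constructor <;> linarith).2
    have hupp := (h₂ ‖x‖ (ball x (2 * r)) hx0 measurableSet_ball fun y hy => by
      have := ball_subset_far (by linarith) hy
      have := norm_nonneg y
      constructor <;> linarith).1
    refine ⟨hpos ‖x‖ _ hx0 (measure_ball_pos _ _ hr) hlow, ?_⟩
    rw [Measure.addHaar_ball_mul volume _ two_pos.le, ENNReal.ofReal_pow two_pos.le,
      ← Measure.addHaar_ball_center volume x] at hupp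
    calc μ (ball x (2 * r)) ≤ C₂ * 2 ^ n * (ENNReal.ofReal (logPowerProfile α β ‖x‖) *
            volume (ball x r)) := hupp.trans_eq (by simp; ring)
      _ ≤ C₂ * 2 ^ n * (C₂ * μ (ball x r)) := by gcongr
      _ = (C₂ * C₂ * 2 ^ n) * μ (ball x r) := by ring
      _ ≤ _ := by gcongr; exact le_add_self

theorem isDoublingMeasure_logPowerWeight {n : ℕ} (hn : 0 < n) {α : ℝ} (β : ℝ)
    (hα : -(n : ℝ) < α) : IsDoublingMeasure (weightMeasure (logPowerWeight n α β)) := by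
  obtain ⟨D, hD, h⟩ := exists_weightMeasure_doubling hn β hα
  refine ⟨D.toReal + 1, by positivity, fun x r hr => ⟨(h x (2 * r) (by positivity)).1,
    (h x r hr).2.trans ?_, ENNReal.mul_lt_top ENNReal.ofReal_lt_top
      (weightMeasure_ball_lt_top hn β hα x r)⟩⟩
  gcongr
  rw [ENNReal.le_ofReal_iff_toReal_le hD (by positivity)]
  linarith

/-! ### The 1-Poincaré inequality in dimension at least 2 -/

theorem exists_lintegral_weightMeasure_ball_abs_sub_const_le {n : ℕ} (hn : 2 ≤ n) {α : ℝ} (β : ℝ)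
    (hα : -(n : ℝ) < α) :
    ∃ C : ℝ≥0∞, C ≠ ∞ ∧ ∀ (F : EuclideanSpace ℝ (Fin n) → ℝ)
      (g : EuclideanSpace ℝ (Fin n) → ℝ≥0∞) (N : Set (EuclideanSpace ℝ (Fin n))),
      Measurable F → Measurable g → MeasurableSet N → volume N = 0 →
      (∀ x ∉ N, ∀ y ∉ N, ENNReal.ofReal |F x - F y| ≤
        ENNReal.ofReal ‖y - x‖ * ∫⁻ t in Icc (0 : ℝ) 1, g (x + t • (y - x))) →
      ∀ (x : EuclideanSpace ℝ (Fin n)) (r : ℝ), 0 < r → ∃ c : ℝ,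
        ∫⁻ y in ball x r, ENNReal.ofReal |F y - c| ∂weightMeasure (logPowerWeight n α β) ≤
          C * ENNReal.ofReal r *
            ∫⁻ y in ball x (8 * r), g y ∂weightMeasure (logPowerWeight n α β) := by
  obtain ⟨C₁, hC₁, h₁⟩ := exists_lintegral_ball_zero_abs_sub_const_le (by omega) β hα
  obtain ⟨C₂, -, h₂⟩ := exists_setLIntegral_weightMeasure_comparable n α β one_le_two
  set K := ENNReal.ofReal C₂ with hK
  have hfr : Module.finrank ℝ (EuclideanSpace ℝ (Fin n)) = n := by simp
  refine ⟨C₁ * (K * K * 8 ^ (n + 1) * 3 + 6) + K * K * 2 ^ (n + 2), by finiteness,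
    fun F g N hF hg hNm hN hseg x r hr => ?_⟩
  set μ := weightMeasure (logPowerWeight n α β) with hμ
  rcases lt_or_ge ‖x‖ (2 * r) with hx | hx
  -- As `|x| < 2r`, one has `B(x,r) ⊆ B(0,3r)` and `B(0,6r) ⊆ B(x,8r)`; this fixes the dilation
  -- factor 8.
  · set R := 3 * r with hR
    have hR0 : 0 < R := by positivity
    have hofR : ENNReal.ofReal R = 3 * ENNReal.ofReal r := by
      rw [hR, ENNReal.ofReal_mul (by norm_num)]; simp
    have hof2R : ENNReal.ofReal (2 * R) = 6 * ENNReal.ofReal r := by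
      rw [show 2 * R = 6 * r by rw [hR]; ring, ENNReal.ofReal_mul (by norm_num)]; simp
    have hsub₁ : ball x r ⊆ ball 0 R := ball_subset_ball' (by rw [dist_zero_right]; linarith)
    have hsub₂ : ball 0 (2 * R) ⊆ ball x (8 * r) :=
      ball_subset_ball' (by rw [dist_zero_left]; linarith)
    obtain ⟨c, hc⟩ := exists_lintegral_originShell_abs_sub_const_le volume (by rw [hfr]; exact hn)
      hF hg hN hseg hR0
    rw [hfr] at hc
    have hupp := (h₂ R (originShell _ R (2 * R)) hR0 (measurableSet_originShell _ _)
      (fun y hy => by constructor <;> linarith [hy.1, hy.2])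
      (fun y => ENNReal.ofReal |F y - c|) (by fun_prop)).1
    have hlow := (h₂ R (originShell _ (R / 2) (2 * R)) hR0 (measurableSet_originShell _ _)
      (fun y hy => by constructor <;> linarith [hy.1, hy.2]) g hg).2
    refine ⟨c, ?_⟩
    have hshell : ∫⁻ y in originShell _ R (2 * R), ENNReal.ofReal |F y - c| ∂μ ≤
        K * K * 8 ^ (n + 1) * ENNReal.ofReal R * ∫⁻ y in ball 0 (2 * R), g y ∂μ := by
      calc _ ≤ K * ENNReal.ofReal (logPowerProfile α β R) * (8 ^ (n + 1) * ENNReal.ofReal R *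
            ∫⁻ z in originShell _ (R / 2) (2 * R), g z) := hupp.trans (by gcongr)
        _ = K * 8 ^ (n + 1) * ENNReal.ofReal R * (ENNReal.ofReal (logPowerProfile α β R) *
            ∫⁻ z in originShell _ (R / 2) (2 * R), g z) := by ring
        _ ≤ K * 8 ^ (n + 1) * ENNReal.ofReal R * (K *
            ∫⁻ z in originShell _ (R / 2) (2 * R), g z ∂μ) := mul_le_mul_right hlow _
        _ ≤ K * 8 ^ (n + 1) * ENNReal.ofReal R * (K * ∫⁻ z in ball 0 (2 * R), g z ∂μ) := by
            gcongr
            exact originShell_subset_ball _ _ _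
        _ = _ := by ring
    calc ∫⁻ y in ball x r, ENNReal.ofReal |F y - c| ∂μ
        ≤ ∫⁻ y in ball 0 R, ENNReal.ofReal |F y - c| ∂μ := lintegral_mono_set hsub₁
      _ ≤ C₁ * (K * K * 8 ^ (n + 1) * ENNReal.ofReal R * (∫⁻ y in ball 0 (2 * R), g y ∂μ) +
            ENNReal.ofReal (2 * R) * ∫⁻ y in ball 0 (2 * R), g y ∂μ) :=
          (h₁ F g N hF hg hNm hN hseg c R).trans (by gcongr)
      _ = C₁ * (K * K * 8 ^ (n + 1) * 3 + 6) * ENNReal.ofReal r *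
            ∫⁻ y in ball 0 (2 * R), g y ∂μ := by rw [hofR, hof2R]; ring
      _ ≤ _ := by
          gcongr
          exact le_self_add
  · have hx0 : 0 < ‖x‖ := by linarith
    obtain ⟨c, hc⟩ := exists_lintegral_ball_abs_sub_const_le volume hF hg hN hseg x hr
    rw [hfr] at hc
    have hupp := (h₂ ‖x‖ (ball x r) hx0 measurableSet_ball (fun y hy => ball_subset_far hx hy)
      (fun y => ENNReal.ofReal |F y - c|) (by fun_prop)).1
    have hlow := (h₂ ‖x‖ (ball x r) hx0 measurableSet_ball (fun y hy => ball_subset_far hx hy)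
      g hg).2
    refine ⟨c, ?_⟩
    calc _ ≤ K * ENNReal.ofReal (logPowerProfile α β ‖x‖) * (2 ^ (n + 2) * ENNReal.ofReal r *
            ∫⁻ z in ball x r, g z) := hupp.trans (by gcongr)
      _ = K * 2 ^ (n + 2) * ENNReal.ofReal r * (ENNReal.ofReal (logPowerProfile α β ‖x‖) *
            ∫⁻ z in ball x r, g z) := by ring
      _ ≤ K * 2 ^ (n + 2) * ENNReal.ofReal r * (K * ∫⁻ z in ball x r, g z ∂μ) :=
          mul_le_mul_right hlow _
      _ = K * K * 2 ^ (n + 2) * ENNReal.ofReal r * ∫⁻ z in ball x r, g z ∂μ := by ring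
      _ ≤ _ := by
          gcongr
          · exact le_add_self
          · linarith

/-- The distance from `c` to the mean, times the total mass, is itself at most the integral of `|F -
c|`. -/
theorem lintegral_abs_sub_average_le {X : Type*} [MeasurableSpace X] {ν : Measure X}
    [IsFiniteMeasure ν] {F : X → ℝ} (hF : Integrable F ν) (c : ℝ) :
    ∫⁻ x, ENNReal.ofReal |F x - ⨍ y, F y ∂ν| ∂ν ≤ 2 * ∫⁻ x, ENNReal.ofReal |F x - c| ∂ν := by
  set m := ⨍ y, F y ∂ν with hm
  have h1 : ENNReal.ofReal |c - m| * ν univ ≤ ∫⁻ x, ENNReal.ofReal |F x - c| ∂ν := by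
    have h2 : ν.real univ * (c - m) = ∫ x, (c - F x) ∂ν := by
      rw [integral_sub (integrable_const c) hF, integral_const, mul_sub, smul_eq_mul,
        ← measure_smul_average, smul_eq_mul]
    have h3 := enorm_integral_le_lintegral_enorm (μ := ν) fun x => c - F x
    rw [← h2, enorm_mul, Real.enorm_of_nonneg measureReal_nonneg, ofReal_measureReal, mul_comm] at h3
    simpa only [Real.enorm_eq_ofReal_abs, abs_sub_comm] using h3
  have hFm := hF.aestronglyMeasurable.aemeasurable
  calc _ ≤ ∫⁻ x, (ENNReal.ofReal |F x - c| + ENNReal.ofReal |c - m|) ∂ν := by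
        refine lintegral_mono fun x => ?_
        rw [← ENNReal.ofReal_add (abs_nonneg _) (abs_nonneg _)]
        exact ENNReal.ofReal_le_ofReal (abs_sub_le _ _ _)
    _ = ∫⁻ x, ENNReal.ofReal |F x - c| ∂ν + ENNReal.ofReal |c - m| * ν univ := by
        rw [lintegral_add_right _ measurable_const, lintegral_const]
    _ ≤ _ := by rw [two_mul]; gcongr

theorem volume_absolutelyContinuous_weightMeasure {n : ℕ} (hn : 0 < n) (α β : ℝ) :
    (volume : Measure (EuclideanSpace ℝ (Fin n))) ≪ weightMeasure (logPowerWeight n α β) := by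
  have : Nonempty (Fin n) := ⟨⟨0, hn⟩⟩
  refine withDensity_absolutelyContinuous'
    (measurable_logPowerWeight n α β).ennreal_ofReal.aemeasurable ?_
  filter_upwards [compl_mem_ae_iff.2 (measure_singleton (0 : EuclideanSpace ℝ (Fin n)))] with x hx
  exact (ENNReal.ofReal_pos.2 (logPowerProfile_pos α β (norm_pos_iff.2 hx))).ne'

theorem abs_coe_sub_coe (a b : ℝ) : ((a : EReal) - (b : EReal)).abs = ENNReal.ofReal |a - b| := by
  rw [← EReal.coe_sub, EReal.abs_def]

theorem supportsPoincare_one_logPowerWeight {n : ℕ} (hn : 2 ≤ n) {α : ℝ} (β : ℝ)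
    (hα : -(n : ℝ) < α) : SupportsPoincare 1 (weightMeasure (logPowerWeight n α β)) := by
  have hn0 : 0 < n := by omega
  obtain ⟨C, hC, hP⟩ := exists_lintegral_weightMeasure_ball_abs_sub_const_le hn β hα
  obtain ⟨D, hD, hdoub⟩ := exists_weightMeasure_doubling hn0 β hα
  have hfin := weightMeasure_ball_lt_top hn0 β hα
  have hac := volume_absolutelyContinuous_weightMeasure hn0 α β
  set μ := weightMeasure (logPowerWeight n α β) with hμ
  have hKtop : 2 * C * D ^ 3 ≠ ∞ := by finiteness
  refine ⟨(2 * C * D ^ 3).toReal + 1, 8, by positivity, by norm_num, fun x r hr f g hf hg => ?_⟩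
  -- `f` is replaced by a real Borel representative. As the weight is positive almost everywhere,
  -- `f` and `F` agree off a Lebesgue null set `N`, and the segment inequality holds for endpoints
  -- outside `N`, which is all that was assumed above.
  set F := hf.2.aestronglyMeasurable.mk _ with hFdef
  have hFm : Measurable F := hf.2.aestronglyMeasurable.stronglyMeasurable_mk.measurable
  have hfF : ∀ᵐ y ∂μ, f y = F y := by
    filter_upwards [hf.1, hf.2.aestronglyMeasurable.ae_eq_mk] with y h1 h2
    rw [hFdef, ← h2, EReal.coe_toReal h1.1 h1.2]
  have hFint : Integrable F μ := hf.2.congr hf.2.aestronglyMeasurable.ae_eq_mk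
  set N := toMeasurable volume {y | ¬ f y = F y} with hNdef
  have hN : volume N = 0 := by
    rw [hNdef, measure_toMeasurable]; exact hac.ae_le hfF
  have hNF : ∀ y ∉ N, f y = F y := fun y hy => by
    by_contra h
    exact hy (subset_toMeasurable _ _ h)
  have hseg : ∀ x ∉ N, ∀ y ∉ N, ENNReal.ofReal |F x - F y| ≤
      ENNReal.ofReal ‖y - x‖ * ∫⁻ t in Icc (0 : ℝ) 1, g (x + t • (y - x)) := by
    intro a ha b hb
    rcases eq_or_ne b a with rfl | hab
    · simp
    · have := hg.abs_sub_le_segment a hab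
      rwa [hNF a ha, hNF b hb, abs_coe_sub_coe] at this
  obtain ⟨c, hc⟩ := hP F g N hFm hg.1 (measurableSet_toMeasurable _ _) hN hseg x r hr
  have hfin' : IsFiniteMeasure (μ.restrict (ball x r)) := ⟨by simpa using hfin x r⟩
  have hav : (⨍ z in ball x r, (f z).toReal ∂μ) = ⨍ z in ball x r, F z ∂μ :=
    average_congr (ae_restrict_of_ae hf.2.aestronglyMeasurable.ae_eq_mk)
  have hlhs : (⨍⁻ y in ball x r,
      (f y - ((⨍ z in ball x r, (f z).toReal ∂μ : ℝ) : EReal)).abs ∂μ) =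
      ⨍⁻ y in ball x r, ENNReal.ofReal |F y - ⨍ z in ball x r, F z ∂μ| ∂μ := by
    rw [hav]
    refine laverage_congr (ae_restrict_of_ae ?_)
    filter_upwards [hfF] with y hy
    rw [hy, abs_coe_sub_coe]
  rw [hlhs]
  simp only [ENNReal.rpow_one, div_one]
  -- Three doublings pass from `r` to `8r`, which turns the integral bound into one between
  -- averages.
  have hd3 : μ (ball x (8 * r)) ≤ D ^ 3 * μ (ball x r) := by
    have e1 := (hdoub x r hr).2
    have e2 := (hdoub x (2 * r) (by positivity)).2
    have e3 := (hdoub x (2 * (2 * r)) (by positivity)).2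
    rw [show 8 * r = 2 * (2 * (2 * r)) by ring]
    calc _ ≤ D * (D * (D * μ (ball x r))) :=
          e3.trans (mul_le_mul_right (e2.trans (mul_le_mul_right e1 _)) _)
      _ = _ := by ring
  have hpos := (hdoub x r hr).1.ne'
  have hpos8 := (hdoub x (8 * r) (by positivity)).1.ne'
  rw [setLAverage_eq, setLAverage_eq, ENNReal.div_le_iff hpos (hfin x r).ne]
  set I := ∫⁻ y in ball x (8 * r), g y ∂μ with hI
  have hI8 : I ≤ I / μ (ball x (8 * r)) * (D ^ 3 * μ (ball x r)) := by
    calc I = I / μ (ball x (8 * r)) * μ (ball x (8 * r)) :=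
          (ENNReal.div_mul_cancel hpos8 (hfin x _).ne).symm
      _ ≤ _ := by gcongr
  calc _ ≤ 2 * (C * ENNReal.ofReal r * I) :=
        (lintegral_abs_sub_average_le hFint.integrableOn c).trans (by gcongr)
    _ ≤ 2 * (C * ENNReal.ofReal r * (I / μ (ball x (8 * r)) * (D ^ 3 * μ (ball x r)))) := by
        gcongr
    _ = 2 * C * D ^ 3 * ENNReal.ofReal r * (I / μ (ball x (8 * r))) * μ (ball x r) := by ring
    _ ≤ _ := by
        rw [ENNReal.ofReal_mul (by positivity)]
        gcongr
        rw [ENNReal.le_ofReal_iff_toReal_le hKtop (by positivity)]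
        linarith

/-! ### Failure on the line -/

theorem tendsto_logPowerProfile_zero {α β : ℝ} (h : 0 < α ∨ (α = 0 ∧ β < 0)) :
    Filter.Tendsto (logPowerProfile α β) (nhdsWithin 0 (Ioi 0)) (nhds 0) := by
  rcases h with h | ⟨rfl, hβ⟩
  · obtain ⟨C, -, hle⟩ := exists_logPowerProfile_div_le α β (half_pos h)
    have h1 : Filter.Tendsto (fun ρ : ℝ => C * ρ ^ (α / 2) * logPowerProfile α β 1)
        (nhdsWithin 0 (Ioi 0)) (nhds 0) := by
      have h2 : Filter.Tendsto (fun ρ : ℝ => ρ ^ (α / 2)) (nhdsWithin 0 (Ioi 0)) (nhds 0) := by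
        have := (Real.continuous_rpow_const (half_pos h).le).tendsto (0 : ℝ)
        rw [Real.zero_rpow (half_pos h).ne'] at this
        exact this.mono_left nhdsWithin_le_nhds
      simpa using (h2.const_mul C).mul_const (logPowerProfile α β 1)
    refine tendsto_of_tendsto_of_tendsto_of_le_of_le' tendsto_const_nhds h1 ?_ ?_
    · filter_upwards [self_mem_nhdsWithin] with ρ hρ
      exact (logPowerProfile_pos α β hρ).le
    · filter_upwards [Ioo_mem_nhdsGT (zero_lt_one' ℝ)] with ρ hρ
      -- Shrinking radius 1 by `s = 1/ρ` bounds the profile at `ρ` by a multiple of `ρ ^ (α / 2)`.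
      have h3 := hle 1 ρ⁻¹ one_pos ((one_le_inv₀ hρ.1).2 hρ.2.le)
      rw [one_div, inv_inv] at h3
      have h4 : ρ⁻¹ ^ (-α + α / 2) = ρ ^ (α / 2) := by
        rw [Real.inv_rpow hρ.1.le, ← Real.rpow_neg hρ.1.le]
        congr 1; ring
      rwa [h4] at h3
  · have h1 : Filter.Tendsto logCutoff (nhdsWithin 0 (Ioi 0)) Filter.atTop :=
      Filter.tendsto_atTop_mono (fun ρ => le_max_right _ _)
        (Filter.tendsto_neg_atBot_atTop.comp Real.tendsto_log_nhdsGT_zero)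
    have h2 := (tendsto_rpow_neg_atTop (neg_pos.2 hβ)).comp h1
    refine h2.congr fun ρ => ?_
    simp [logPowerProfile]

theorem HasUnitSpeedOn.lipschitzOnWith {X : Type*} [PseudoEMetricSpace X] {γ : ℝ → X} {s : Set ℝ}
    (h : HasUnitSpeedOn γ s) : LipschitzOnWith 1 γ s := by
  have key : ∀ a ∈ s, ∀ b ∈ s, a ≤ b → edist (γ a) (γ b) ≤ edist a b := by
    intro a ha b hb hab
    have h1 := eVariationOn.edist_le γ (s := s ∩ Icc a b) ⟨ha, le_rfl, hab⟩ ⟨hb, hab, le_rfl⟩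
    rw [h ha hb] at h1
    refine h1.trans_eq ?_
    rw [edist_comm, edist_dist, Real.dist_eq, abs_of_nonneg (by linarith)]
    simp
  intro a ha b hb
  rw [ENNReal.coe_one, one_mul]
  rcases le_total a b with hab | hab
  · exact key a ha b hb hab
  · rw [edist_comm, edist_comm a]; exact key b hb a ha hab

/-- The ramp that vanishes on `(-∞,0]`, is affine on `[0,ε]` and equals `1` on `[ε,∞)`. -/
noncomputable def unitRamp (ε x : ℝ) : ℝ := ε⁻¹ * max 0 (min ε x)

theorem ofReal_abs_unitRamp_sub_le {ε : ℝ} (hε : 0 < ε) (a b : ℝ) :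
    ENNReal.ofReal |unitRamp ε a - unitRamp ε b| ≤
      ENNReal.ofReal ε⁻¹ * volume (uIcc a b ∩ Icc 0 ε) := by
  wlog hab : a ≤ b generalizing a b
  · rw [abs_sub_comm, uIcc_comm]; exact this b a (le_of_not_ge hab)
  rw [uIcc_of_le hab, Icc_inter_Icc, Real.volume_Icc, ← ENNReal.ofReal_mul (by positivity),
    unitRamp, unitRamp, ← mul_sub, abs_mul, abs_of_pos (inv_pos.2 hε), ENNReal.ofReal_mul
    (by positivity), ENNReal.ofReal_mul (by positivity)]
  refine mul_le_mul_right ?_ _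
  by_cases h : a ≤ ε ∧ 0 ≤ b
  · refine ENNReal.ofReal_le_ofReal ?_
    rw [abs_sub_comm, abs_of_nonneg (sub_nonneg.2 (by gcongr)), min_eq_right h.1]
    simp only [max_comm a 0, min_comm b ε, max_eq_right (le_min hε.le h.2)]
    exact le_rfl
  · rw [not_and_or, not_le, not_le] at h
    have : max 0 (min ε a) - max 0 (min ε b) = 0 := by
      rcases h with h | h
      · rw [min_eq_left h.le, min_eq_left (h.le.trans hab), sub_self]
      · rw [max_eq_left ((min_le_right _ _).trans h.le),
          max_eq_left ((min_le_right _ _).trans (hab.trans h.le)), sub_self]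
    rw [this]; simp

/-- By the intermediate value theorem the curve covers the part of `[0,ε]` between its endpoints,
and a 1-Lipschitz map does not increase length; so the time spent in `[0,ε]` is at least the length
covered there. -/
theorem ofReal_abs_unitRamp_sub_le_of_lipschitzOnWith {ε : ℝ} (hε : 0 < ε) {c : ℝ → ℝ} {l : ℝ}
    (hl : 0 ≤ l) (hc : LipschitzOnWith 1 c (Icc 0 l)) :
    ENNReal.ofReal |unitRamp ε (c 0) - unitRamp ε (c l)| ≤
      ENNReal.ofReal ε⁻¹ * volume (Icc 0 l ∩ c ⁻¹' Icc 0 ε) := by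
  refine (ofReal_abs_unitRamp_sub_le hε _ _).trans (mul_le_mul_right ?_ _)
  have h1 : uIcc (c 0) (c l) ∩ Icc 0 ε ⊆ c '' (Icc 0 l ∩ c ⁻¹' Icc 0 ε) := by
    rintro y ⟨hy, hy'⟩
    have hcont : ContinuousOn c (uIcc 0 l) := by rw [uIcc_of_le hl]; exact hc.continuousOn
    obtain ⟨t, ht, rfl⟩ := intermediate_value_uIcc hcont hy
    rw [uIcc_of_le hl] at ht
    exact ⟨t, ⟨ht, hy'⟩, rfl⟩
  have h2 := (hc.mono inter_subset_left : LipschitzOnWith 1 c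
    (Icc 0 l ∩ c ⁻¹' Icc 0 ε)).hausdorffMeasure_image_le zero_le_one
  rw [hausdorffMeasure_real] at h2
  simp only [ENNReal.coe_one, ENNReal.one_rpow, one_mul] at h2
  exact (measure_mono h1).trans h2

theorem exists_Ioo_subset_preimage_Ioi {c : ℝ → ℝ} {l L t : ℝ} (hl : 0 < l)
    (hc : LipschitzOnWith 1 c (Icc 0 l)) (ht : t ∈ Icc 0 l) (hL : L < c t) :
    ∃ a b, a < b ∧ Ioo a b ⊆ Icc 0 l ∩ c ⁻¹' Ioi L := by
  set η := c t - L with hη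
  have hη0 : 0 < η := sub_pos.2 hL
  have hlt : max 0 (t - η) < min l (t + η) :=
    max_lt (lt_min hl (by linarith [ht.1])) (lt_min (by linarith [ht.2]) (by linarith))
  refine ⟨max 0 (t - η), min l (t + η), hlt, fun s hs => ?_⟩
  have h1 := max_lt_iff.1 hs.1
  have h2 := lt_min_iff.1 hs.2
  have hs' : s ∈ Icc 0 l := ⟨h1.1.le, h2.1.le⟩
  refine ⟨hs', ?_⟩
  have h3 := hc.dist_le_mul t ht s hs'
  rw [NNReal.coe_one, one_mul, Real.dist_eq, Real.dist_eq] at h3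
  have h4 : |t - s| < η := abs_lt.2 ⟨by linarith, by linarith⟩
  have h5 := le_abs_self (c t - c s)
  show L < c s
  linarith

/-- A compactly supported function on the line with a jump at `L` and a ramp on `[0,ε]`. -/
noncomputable def cutRamp (ε L : ℝ) (x : EuclideanSpace ℝ (Fin 1)) : ℝ :=
  if L < x 0 then 0 else unitRamp ε (x 0)

/-- An upper gradient of `cutRamp ε L`. -/
noncomputable def cutRampGradient (ε L : ℝ) (x : EuclideanSpace ℝ (Fin 1)) : ℝ≥0∞ :=
  if L < x 0 then ∞ else if x 0 ∈ Icc 0 ε then ENNReal.ofReal ε⁻¹ else 0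

theorem measurable_cutRamp (ε L : ℝ) : Measurable (cutRamp ε L) := by
  unfold cutRamp unitRamp
  exact Measurable.ite (measurableSet_lt measurable_const (by fun_prop)) measurable_const
    (by fun_prop)

theorem measurable_cutRampGradient (ε L : ℝ) : Measurable (cutRampGradient ε L) := by
  unfold cutRampGradient
  have hm : Measurable fun x : EuclideanSpace ℝ (Fin 1) => x 0 := by fun_prop
  exact Measurable.ite (measurableSet_lt measurable_const hm) measurable_const
    (Measurable.ite (hm measurableSet_Icc) measurable_const measurable_const)

theorem isUpperGradient_cutRamp {ε : ℝ} (hε : 0 < ε) (L : ℝ) :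
    IsUpperGradient (cutRampGradient ε L) fun x => (cutRamp ε L x : EReal) := by
  refine ⟨measurable_cutRampGradient ε L, fun l γ hl hγ => ?_⟩
  set c : ℝ → ℝ := fun t => γ t 0 with hcdef
  have hc : LipschitzOnWith 1 c (Icc 0 l) := by
    intro a ha b hb
    refine le_trans ?_ (hγ.lipschitzOnWith ha hb)
    rw [edist_dist, edist_dist]
    refine ENNReal.ofReal_le_ofReal ?_
    rw [dist_eq_norm, dist_eq_norm]
    exact PiLp.norm_apply_le (γ a - γ b) 0
  -- A curve that enters `x > L` stays there for a positive time, where the gradient is infinite, so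
  -- the jump at `L` is harmless. Otherwise only the ramp matters.
  by_cases h : ∃ t ∈ Icc 0 l, L < c t
  · obtain ⟨t, ht, hLt⟩ := h
    obtain ⟨a, b, hab, hsub⟩ := exists_Ioo_subset_preimage_Ioi hl hc ht hLt
    have htop : ∫⁻ t in Ioo a b, cutRampGradient ε L (γ t) = ∞ := by
      have hg : ∀ t ∈ Ioo a b, cutRampGradient ε L (γ t) = ∞ := fun t ht => if_pos (hsub ht).2
      rw [setLIntegral_congr_fun measurableSet_Ioo hg, setLIntegral_const,
        Real.volume_Ioo, ENNReal.top_mul (ENNReal.ofReal_pos.2 (sub_pos.2 hab)).ne']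
    exact le_top.trans (htop.ge.trans (lintegral_mono_set fun t ht => (hsub ht).1))
  · push Not at h
    have h0 := h 0 (left_mem_Icc.2 hl.le)
    have h1 := h l (right_mem_Icc.2 hl.le)
    have hT : MeasurableSet (Icc 0 l ∩ c ⁻¹' Icc 0 ε) :=
      (hc.continuousOn.preimage_isClosed_of_isClosed isClosed_Icc isClosed_Icc).measurableSet
    rw [abs_coe_sub_coe, cutRamp, cutRamp, if_neg h0.not_gt, if_neg h1.not_gt]
    refine (ofReal_abs_unitRamp_sub_le_of_lipschitzOnWith hε hl.le hc).trans ?_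
    rw [← setLIntegral_const]
    refine (setLIntegral_mono' hT fun t ht => ?_).trans (lintegral_mono_set inter_subset_left)
    rw [cutRampGradient, if_neg (h t ht.1).not_gt, if_pos (show γ t 0 ∈ Icc 0 ε from ht.2)]

theorem unitRamp_mem_Icc {ε : ℝ} (hε : 0 < ε) (x : ℝ) : unitRamp ε x ∈ Icc (0 : ℝ) 1 := by
  refine ⟨mul_nonneg (by positivity) (le_max_left _ _), ?_⟩
  rw [unitRamp, inv_mul_le_one₀ hε]
  exact max_le hε.le (min_le_left _ _)

theorem norm_euclidean_one (x : EuclideanSpace ℝ (Fin 1)) : ‖x‖ = |x 0| := by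
  simp [EuclideanSpace.norm_eq, Real.sqrt_sq_eq_abs]

theorem integrable_cutRamp {μ : Measure (EuclideanSpace ℝ (Fin 1))} {ε L : ℝ} (hε : 0 < ε)
    (hμ : μ (ball 0 (L + 1)) < ∞) : Integrable (cutRamp ε L) μ := by
  have h1 : IntegrableOn (fun _ => (1 : ℝ)) (ball (0 : EuclideanSpace ℝ (Fin 1)) (L + 1)) μ :=
    integrableOn_const hμ.ne
  refine ((integrable_indicator_iff measurableSet_ball).2 h1).mono'
    (measurable_cutRamp ε L).aestronglyMeasurable (Filter.Eventually.of_forall fun x => ?_)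
  have hr := unitRamp_mem_Icc hε (x 0)
  by_cases hx : x ∈ ball (0 : EuclideanSpace ℝ (Fin 1)) (L + 1)
  · rw [indicator_of_mem hx, cutRamp]
    split_ifs
    · simp
    · rw [Real.norm_of_nonneg hr.1]; exact hr.2
  · rw [indicator_of_notMem hx, cutRamp]
    split_ifs with h
    · simp
    · rw [mem_ball_zero_iff, norm_euclidean_one, not_lt] at hx
      have hx0 : x 0 ≤ 0 := by
        by_contra! h'
        rw [abs_of_pos h'] at hx
        linarith
      rw [unitRamp, max_eq_left ((min_le_right _ _).trans hx0)]
      simp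

theorem coord_mem_of_mem_ball_single {x : EuclideanSpace ℝ (Fin 1)} {a r : ℝ}
    (hx : x ∈ ball (EuclideanSpace.single 0 a) r) : |x 0 - a| < r := by
  rw [mem_ball_iff_norm, norm_euclidean_one] at hx
  simpa using hx

/-- The function is 0 on the left ball and 1 on the right one, and every constant is at distance at
least 1/2 from 0 or from 1. -/
theorem lintegral_abs_cutRamp_sub_const_ge {μ : Measure (EuclideanSpace ℝ (Fin 1))} {ε L : ℝ}
    (hε : 0 < ε) (hε1 : ε ≤ 1 / 2) (hL : 1 ≤ L) (c : ℝ) :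
    ENNReal.ofReal (1 / 2) * min (μ (ball (EuclideanSpace.single 0 (-3 / 4)) (1 / 4)))
        (μ (ball (EuclideanSpace.single 0 (3 / 4)) (1 / 4))) ≤
      ∫⁻ x in ball 0 1, ENNReal.ofReal |cutRamp ε L x - c| ∂μ := by
  have key : ∀ a v : ℝ, |a| + 1 / 4 ≤ 1 → (∀ t, |t - a| < 1 / 4 → unitRamp ε t = v) →
      1 / 2 ≤ |v - c| → ENNReal.ofReal (1 / 2) * μ (ball (EuclideanSpace.single 0 a) (1 / 4)) ≤
        ∫⁻ x in ball 0 1, ENNReal.ofReal |cutRamp ε L x - c| ∂μ := by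
    intro a v ha hv hc
    have hsub : ball (EuclideanSpace.single (0 : Fin 1) a) (1 / 4) ⊆ ball 0 1 :=
      ball_subset_ball' (by rw [dist_zero_right, norm_euclidean_one]; simp; linarith)
    rw [← setLIntegral_const]
    refine (setLIntegral_mono' measurableSet_ball fun x hx => ?_).trans (lintegral_mono_set hsub)
    have h1 := mem_ball_zero_iff.1 (hsub hx)
    rw [norm_euclidean_one] at h1
    rw [cutRamp, if_neg (by linarith [le_abs_self (x 0)]), hv _ (coord_mem_of_mem_ball_single hx)]
    exact ENNReal.ofReal_le_ofReal hc
  rcases le_total (1 / 2) c with hc | hc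
  · refine (mul_le_mul_right (min_le_left _ _) _).trans
      (key (-3 / 4) 0 (by norm_num [abs_of_neg]) (fun t ht => ?_) ?_)
    · rw [unitRamp, max_eq_left ((min_le_right _ _).trans (by linarith [(abs_lt.1 ht).2])), mul_zero]
    · rw [zero_sub, abs_neg]; exact hc.trans (le_abs_self c)
  · refine (mul_le_mul_right (min_le_right _ _) _).trans
      (key (3 / 4) 1 (by norm_num [abs_of_pos]) (fun t ht => ?_) ?_)
    · rw [unitRamp, min_eq_left (by linarith [(abs_lt.1 ht).1]), max_eq_right hε.le,
        inv_mul_cancel₀ hε.ne']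
    · exact le_trans (by linarith) (le_abs_self (1 - c))

/-- Inside the ball of radius `L` the infinite part of the gradient is not seen. What remains is at
most `δ/ε` on a ball of radius `ε`, whose volume is proportional to `ε`. -/
theorem lintegral_cutRampGradient_le {α β ε δ : ℝ} (hε : 0 < ε)
    (hδ : ∀ ρ, 0 < ρ → ρ ≤ ε → logPowerProfile α β ρ ≤ δ) (L : ℝ) :
    ∫⁻ x in ball 0 L, cutRampGradient ε L x ∂weightMeasure (logPowerWeight 1 α β) ≤
      ENNReal.ofReal δ * volume (ball (0 : EuclideanSpace ℝ (Fin 1)) 1) := by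
  rw [setLIntegral_weightMeasure (measurable_logPowerWeight 1 α β) (measurable_cutRampGradient ε L)
    measurableSet_ball]
  have h1 : ∀ᵐ x ∂(volume : Measure (EuclideanSpace ℝ (Fin 1))).restrict (ball 0 L),
      ENNReal.ofReal (logPowerWeight 1 α β x) * cutRampGradient ε L x ≤
        (closedBall 0 ε).indicator (fun _ => ENNReal.ofReal δ * ENNReal.ofReal ε⁻¹) x := by
    filter_upwards [ae_restrict_mem measurableSet_ball, ae_restrict_of_ae
      (compl_mem_ae_iff.2 (measure_singleton (0 : EuclideanSpace ℝ (Fin 1))))] with x hx hx0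
    rw [mem_ball_zero_iff, norm_euclidean_one] at hx
    rw [cutRampGradient, if_neg (by linarith [le_abs_self (x 0)])]
    split_ifs with h
    · have hxε : ‖x‖ ≤ ε := by rw [norm_euclidean_one, abs_of_nonneg h.1]; exact h.2
      rw [indicator_of_mem (mem_closedBall_zero_iff.2 hxε)]
      gcongr
      exact hδ ‖x‖ (norm_pos_iff.2 hx0) hxε
    · simp
  calc _ ≤ ∫⁻ x, (closedBall 0 ε).indicator (fun _ => ENNReal.ofReal δ * ENNReal.ofReal ε⁻¹) x :=
        (lintegral_mono_ae h1).trans (setLIntegral_le_lintegral _ _)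
    _ = ENNReal.ofReal δ * (ENNReal.ofReal (ε⁻¹ * ε) *
          volume (ball (0 : EuclideanSpace ℝ (Fin 1)) 1)) := by
        rw [lintegral_indicator measurableSet_closedBall, setLIntegral_const,
          Measure.addHaar_closedBall volume _ hε.le, ENNReal.ofReal_mul (by positivity)]
        simp [mul_assoc]
    _ = _ := by rw [inv_mul_cancel₀ hε.ne', ENNReal.ofReal_one, one_mul]

theorem not_supportsPoincare_one_logPowerWeight {α β : ℝ} (h : 0 < α ∨ (α = 0 ∧ β < 0)) :
    ¬ SupportsPoincare 1 (weightMeasure (logPowerWeight 1 α β)) := by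
  have hα : -((1 : ℕ) : ℝ) < α := by
    rw [Nat.cast_one]
    rcases h with h | h <;> linarith [h]
  obtain ⟨D, -, hdoub⟩ := exists_weightMeasure_doubling one_pos β hα
  have hfin := weightMeasure_ball_lt_top one_pos β hα
  set μ := weightMeasure (logPowerWeight 1 α β) with hμ
  rintro ⟨C, L, hC, hL, hP⟩
  set m := ENNReal.ofReal (1 / 2) * min (μ (ball (EuclideanSpace.single 0 (-3 / 4)) (1 / 4)))
        (μ (ball (EuclideanSpace.single 0 (3 / 4)) (1 / 4))) with hm
  set V := volume (ball (0 : EuclideanSpace ℝ (Fin 1)) 1) with hV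
  have hm0 : 0 < m := ENNReal.mul_pos (by simp)
    (lt_min (hdoub _ _ (by norm_num)).1 (hdoub _ _ (by norm_num)).1).ne'
  have hmtop : m ≠ ∞ := ENNReal.mul_ne_top ENNReal.ofReal_ne_top
    ((min_le_left _ _).trans_lt (hfin _ _)).ne
  have hVtop : V ≠ ∞ := measure_ball_lt_top.ne
  have hm0' : 0 < m.toReal := ENNReal.toReal_pos hm0.ne' hmtop
  -- Chosen so that `C δ (V + 1) = m/2`, contradicting `m ≤ C δ V`.
  set δ := m.toReal / (2 * C * (V.toReal + 1)) with hδ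
  have hδ0 : 0 < δ := by positivity
  obtain ⟨ε₀, hε₀, hsmall⟩ : ∃ ε₀ > 0, ∀ ρ, 0 < ρ → ρ < ε₀ → logPowerProfile α β ρ ≤ δ := by
    have := (tendsto_logPowerProfile_zero h).eventually (Iio_mem_nhds hδ0)
    obtain ⟨ε₀, hε₀, hsub⟩ := mem_nhdsGT_iff_exists_Ioo_subset.1 this
    exact ⟨ε₀, hε₀, fun ρ h1 h2 => (hsub ⟨h1, h2⟩).le⟩
  set ε := min (ε₀ / 2) (1 / 2) with hεdef
  have hε : 0 < ε := lt_min (by linarith) (by norm_num)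
  have hεε₀ : ε < ε₀ := (min_le_left _ _).trans_lt (by linarith)
  -- The cut is placed at the dilation factor `L` of the assumed inequality: this makes the test
  -- function integrable, and `B(0,L)` does not reach beyond the cut.
  have hgrad := lintegral_cutRampGradient_le hε
    (fun ρ h1 h2 => hsmall ρ h1 (h2.trans_lt hεε₀)) L
  have hPf := hP 0 1 one_pos (fun x => (cutRamp ε L x : EReal)) (cutRampGradient ε L)
    ⟨by simp, by simpa using integrable_cutRamp hε (hfin _ _)⟩ (isUpperGradient_cutRamp hε L)
  simp only [EReal.toReal_coe, abs_coe_sub_coe, ENNReal.rpow_one, div_one, mul_one] at hPf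
  have hB0 := (hdoub 0 1 one_pos).1.ne'
  rw [setLAverage_eq, setLAverage_eq, ENNReal.div_le_iff hB0 (hfin 0 1).ne] at hPf
  have hchain : m ≤ ENNReal.ofReal C * (ENNReal.ofReal δ * V) := by
    calc m ≤ _ := lintegral_abs_cutRamp_sub_const_ge hε (min_le_right _ _) hL _
      _ ≤ _ := hPf
      _ ≤ ENNReal.ofReal C * (ENNReal.ofReal δ * V / μ (ball 0 1)) * μ (ball 0 1) := by
          gcongr
      _ = _ := by rw [mul_assoc, ENNReal.div_mul_cancel hB0 (hfin 0 1).ne]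
  have hreal := ENNReal.toReal_mono (by finiteness) hchain
  clear_value m
  rw [ENNReal.toReal_mul, ENNReal.toReal_mul, ENNReal.toReal_ofReal hC.le,
    ENNReal.toReal_ofReal hδ0.le] at hreal
  have hV0 : 0 ≤ V.toReal := ENNReal.toReal_nonneg
  have hδeq : C * (δ * (V.toReal + 1)) = m.toReal / 2 := by
    rw [hδ]; field_simp
  nlinarith [mul_pos hC hδ0]

theorem mainTheorem12 :
    (∀ (n : ℕ) (α β : ℝ), 2 ≤ n → -(n : ℝ) < α →
      IsAdmissibleWeight 1 (logPowerWeight n α β)) ∧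
    (∀ α β : ℝ, (0 < α ∨ (α = 0 ∧ β < 0)) →
      IsWeight (logPowerWeight 1 α β) ∧ ¬ IsAdmissibleWeight 1 (logPowerWeight 1 α β)) := by
  refine ⟨fun n α β hn hα => ?_, fun α β h => ⟨?_, fun hadm => ?_⟩⟩
  · have hn0 : 0 < n := by omega
    exact ⟨isWeight_logPowerWeight hn0 β hα, isDoublingMeasure_logPowerWeight hn0 β hα,
      supportsPoincare_one_logPowerWeight hn β hα⟩
  · refine isWeight_logPowerWeight one_pos β ?_
    rw [Nat.cast_one]
    rcases h with h | h <;> linarith [h]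
  · exact not_supportsPoincare_one_logPowerWeight h hadm.2.2
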